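/- Let $d\ge 1$, let $\Omega\subset\mathbb{R}^d$ be a bounded open set, let $y_d,u_d\in L^2(\Omega)$ and $\nu>0$. Put $a(y,v)=\int_\Omega \nabla y\cdot\nabla v\,dx$ for $y,v\in H_0^1(\Omega)$ and $$J(y,u)=\tfrac12\|y-y_d\|_{L^2(\Omega)}^2+\tfrac{\nu}{2}\|u-u_d\|_{L^2(\Omega)}^2 .$$ Consider the optimal control problem $$\text{(P)}\qquad \min_{(y,u)\in H_0^1(\Omega)\times L^2(\Omega)} J(y,u)\quad\text{s.t.}\quad a(y,v-y)+\|v\|_{L^1(\Omega)}-\|y\|_{L^1(\Omega)}\ge \int_\Omega u\,(v-y)\,dx\quad\forall v\in H_0^1(\Omega),$$ and, for $\bar u\in L^2(\Omega)$ and $\gamma>0$, the penalized and regularized problem $$\text{(P}_\gamma\text{)}\qquad \min_{(y,u)\in H_0^1(\Omega)\times L^2(\Omega)} J(y,u)+\|u-\bar u\|_{L^2(\Omega)}^2\quad\text{s.t.}\quad a(y,v)+\frac{2}{\pi}\int_\Omega \arctan(\gamma y)\,v\,dx=\int_\Omega u\,v\,dx\quad\forall v\in H_0^1(\Omega).$$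 A control $u\in L^2(\Omega)$ is called a local solution of one of these problems if there are a state $y\in H_0^1(\Omega)$ such that $(y,u)$ is feasible and an $\varepsilon>0$ such that the objective value at $(y,u)$ is at most the objective value at $(y',u')$ for every feasible pair $(y',u')$ with $\|u'-u\|_{L^2(\Omega)}\le\varepsilon$. Let $\bar u\in L^2(\Omega)$ be a local solution of (P). Then there is a family $(\bar u_\gamma)_{\gamma>0}$ in $L^2(\Omega)$ such that $\bar u_\gamma$ is a local solution of (P$_\gamma$) (formed with this $\bar u$) for every $\gamma>0$, and $\bar u_\gamma\to\bar u$ strongly in $L^2(\Omega)$ as $\gamma\to\infty$. -/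

import Mathlib

open MeasureTheory Filter Topology TopologicalSpace
open scoped Gradient Distributions

noncomputable section

namespace VIControl

/-- The Euclidean space `ℝ^d`. -/
abbrev Space (d : ℕ) := EuclideanSpace ℝ (Fin d)

variable {d : ℕ}

/-- The Lebesgue space `L²(Ω)`. -/
abbrev L2 (Ω : Opens (Space d)) :=
  Lp ℝ 2 ((volume : Measure (Space d)).restrict (Ω : Set (Space d)))

/-- The Lebesgue space `L²(Ω; ℝ^d)` of vector fields. -/
abbrev L2Vec (Ω : Opens (Space d)) :=
  Lp (Space d) 2 ((volume : Measure (Space d)).restrict (Ω : Set (Space d)))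

/-- `g` is the weak gradient of `y` on `Ω`: `∫_Ω y ∇φ = -∫_Ω φ g` (an identity of vectors)
for all test functions `φ ∈ C_c^∞(Ω)`. -/
def IsWeakGradient {Ω : Opens (Space d)} (y : L2 Ω) (g : L2Vec Ω) : Prop :=
  ∀ φ : 𝓓(Ω, ℝ),
    ∫ x in (Ω : Set (Space d)), y x • ∇ φ x = - ∫ x in (Ω : Set (Space d)), φ x • g x

lemma gradient_add_test {Ω : Opens (Space d)} (φ ψ : 𝓓(Ω, ℝ)) (x : Space d) :
    ∇ (φ + ψ : 𝓓(Ω, ℝ)) x = ∇ φ x + ∇ ψ x := by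
  have h1 : DifferentiableAt ℝ φ x := (φ.contDiff.differentiable (by simp)) x
  have h2 : DifferentiableAt ℝ ψ x := (ψ.contDiff.differentiable (by simp)) x
  simp only [gradient, FunLike.coe_add]
  rw [fderiv_add h1 h2, map_add]

lemma gradient_smul_test {Ω : Opens (Space d)} (c : ℝ) (φ : 𝓓(Ω, ℝ)) (x : Space d) :
    ∇ (c • φ : 𝓓(Ω, ℝ)) x = c • ∇ φ x := by
  have h1 : DifferentiableAt ℝ φ x := (φ.contDiff.differentiable (by simp)) x
  simp only [gradient, FunLike.coe_smul]
  rw [fderiv_const_smul h1]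
  simp

lemma continuous_gradient_test {Ω : Opens (Space d)} (φ : 𝓓(Ω, ℝ)) : Continuous (∇ φ) :=
  (InnerProductSpace.toDual ℝ (Space d)).symm.continuous.comp
    (φ.contDiff.continuous_fderiv (by simp))

lemma hasCompactSupport_gradient_test {Ω : Opens (Space d)} (φ : 𝓓(Ω, ℝ)) :
    HasCompactSupport (∇ φ) :=
  (φ.hasCompactSupport.fderiv (𝕜 := ℝ)).comp_left
    (g := (InnerProductSpace.toDual ℝ (Space d)).symm) (map_zero _)

lemma integrable_smul_gradient {Ω : Opens (Space d)} (y : L2 Ω) (φ : 𝓓(Ω, ℝ)) :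
    Integrable (fun x => y x • ∇ φ x)
      ((volume : Measure (Space d)).restrict (Ω : Set (Space d))) :=
  memLp_one_iff_integrable.1 <| MemLp.smul (p := 2) (q := 2) (r := 1)
    ((continuous_gradient_test φ).memLp_of_hasCompactSupport (hasCompactSupport_gradient_test φ))
    (Lp.memLp y)

lemma integrable_test_smul {Ω : Opens (Space d)} (φ : 𝓓(Ω, ℝ)) (g : L2Vec Ω) :
    Integrable (fun x => φ x • g x)
      ((volume : Measure (Space d)).restrict (Ω : Set (Space d))) :=
  memLp_one_iff_integrable.1 <| MemLp.smul (p := 2) (q := 2) (r := 1)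
    (Lp.memLp g) (φ.continuous.memLp_of_hasCompactSupport φ.hasCompactSupport)

/-- The Sobolev space `H¹(Ω)`: pairs `(y, ∇y)` of an `L²` function and its (unique) weak gradient
in `L²`, with the norm `(‖y‖² + ‖∇y‖²)^{1/2}`. -/
def H1 (Ω : Opens (Space d)) : Submodule ℝ (WithLp 2 (L2 Ω × L2Vec Ω)) where
  carrier := {p | IsWeakGradient p.fst p.snd}
  zero_mem' := by
    intro φ
    have h1 : ∫ x in (Ω : Set (Space d)), (0 : L2 Ω) x • ∇ φ x
        = ∫ x in (Ω : Set (Space d)), (0 : Space d) := by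
      refine integral_congr_ae ?_
      filter_upwards [Lp.coeFn_zero ℝ 2 (volume.restrict (Ω : Set (Space d)))] with x hx
      rw [hx]; simp
    have h2 : ∫ x in (Ω : Set (Space d)), φ x • (0 : L2Vec Ω) x
        = ∫ x in (Ω : Set (Space d)), (0 : Space d) := by
      refine integral_congr_ae ?_
      filter_upwards [Lp.coeFn_zero (Space d) 2 (volume.restrict (Ω : Set (Space d)))] with x hx
      rw [hx]; simp
    rw [WithLp.zero_fst, WithLp.zero_snd, h1, h2]
    simp
  add_mem' := by
    intro p q hp hq φ
    have h1 : ∫ x in (Ω : Set (Space d)), (p.fst + q.fst) x • ∇ φ x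
        = ∫ x in (Ω : Set (Space d)), (p.fst x • ∇ φ x + q.fst x • ∇ φ x) := by
      refine integral_congr_ae ?_
      filter_upwards [Lp.coeFn_add p.fst q.fst] with x hx
      rw [hx, Pi.add_apply, add_smul]
    have h2 : ∫ x in (Ω : Set (Space d)), φ x • (p.snd + q.snd) x
        = ∫ x in (Ω : Set (Space d)), (φ x • p.snd x + φ x • q.snd x) := by
      refine integral_congr_ae ?_
      filter_upwards [Lp.coeFn_add p.snd q.snd] with x hx
      rw [hx, Pi.add_apply, smul_add]
    rw [WithLp.add_fst, WithLp.add_snd, h1, h2,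
      integral_add (integrable_smul_gradient _ _) (integrable_smul_gradient _ _),
      integral_add (integrable_test_smul _ _) (integrable_test_smul _ _), hp φ, hq φ, neg_add]
  smul_mem' := by
    intro c p hp φ
    have h1 : ∫ x in (Ω : Set (Space d)), (c • p.fst) x • ∇ φ x
        = ∫ x in (Ω : Set (Space d)), c • (p.fst x • ∇ φ x) := by
      refine integral_congr_ae ?_
      filter_upwards [Lp.coeFn_smul c p.fst] with x hx
      rw [hx, Pi.smul_apply, smul_assoc]
    have h2 : ∫ x in (Ω : Set (Space d)), φ x • (c • p.snd) x
        = ∫ x in (Ω : Set (Space d)), c • (φ x • p.snd x) := by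
      refine integral_congr_ae ?_
      filter_upwards [Lp.coeFn_smul c p.snd] with x hx
      rw [hx, Pi.smul_apply, smul_comm]
    rw [WithLp.smul_fst, WithLp.smul_snd, h1, h2, integral_smul, integral_smul, hp φ, smul_neg]

/-- The subspace of `H¹(Ω)` formed by (the classes of) the test functions `φ ∈ C_c^∞(Ω)`. -/
def testH1 (Ω : Opens (Space d)) : Submodule ℝ (H1 Ω) where
  carrier := {p | ∃ φ : 𝓓(Ω, ℝ),
    p.1.fst =ᵐ[volume.restrict (Ω : Set (Space d))] φ ∧
    p.1.snd =ᵐ[volume.restrict (Ω : Set (Space d))] ∇ φ}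
  zero_mem' := by
    refine ⟨0, ?_, ?_⟩
    · filter_upwards [Lp.coeFn_zero ℝ 2 (volume.restrict (Ω : Set (Space d)))] with x hx
      simpa using hx
    · filter_upwards [Lp.coeFn_zero (Space d) 2 (volume.restrict (Ω : Set (Space d)))] with x hx
      have : (∇ (0 : 𝓓(Ω, ℝ)) : Space d → Space d) x = 0 := by
        have := gradient_smul_test (0 : ℝ) (0 : 𝓓(Ω, ℝ)) x
        simpa only [zero_smul] using this
      rw [this]; simpa using hx
  add_mem' := by
    rintro p q ⟨φ, h1, h2⟩ ⟨ψ, h3, h4⟩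
    refine ⟨φ + ψ, ?_, ?_⟩
    · filter_upwards [Lp.coeFn_add p.1.fst q.1.fst, h1, h3] with x hx h h'
      refine hx.trans ?_
      rw [Pi.add_apply, h, h', FunLike.coe_add, Pi.add_apply]
    · filter_upwards [Lp.coeFn_add p.1.snd q.1.snd, h2, h4] with x hx h h'
      refine hx.trans ?_
      rw [Pi.add_apply, h, h', gradient_add_test]
  smul_mem' := by
    rintro c p ⟨φ, h1, h2⟩
    refine ⟨c • φ, ?_, ?_⟩
    · filter_upwards [Lp.coeFn_smul c p.1.fst, h1] with x hx h
      refine hx.trans ?_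
      rw [Pi.smul_apply, h, FunLike.coe_smul, Pi.smul_apply]
    · filter_upwards [Lp.coeFn_smul c p.1.snd, h2] with x hx h
      refine hx.trans ?_
      rw [Pi.smul_apply, h, gradient_smul_test]

/-- The Sobolev space `H₀¹(Ω)`: the closure of `C_c^∞(Ω)` in `H¹(Ω)`. -/
def H01 (Ω : Opens (Space d)) : Submodule ℝ (H1 Ω) := (testH1 Ω).topologicalClosure

variable {Ω : Opens (Space d)}

/-- The function `y ∈ L²(Ω)` underlying `y ∈ H₀¹(Ω)`. -/
def stateFn (y : H01 Ω) : L2 Ω := y.1.1.fst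

/-- The weak gradient `∇y ∈ L²(Ω; ℝ^d)` of `y ∈ H₀¹(Ω)`. -/
def stateGrad (y : H01 Ω) : L2Vec Ω := y.1.1.snd

/-- The bilinear form `a(y, v) = ∫_Ω ∇y · ∇v`. -/
def dirichletForm (y v : H01 Ω) : ℝ :=
  ∫ x in (Ω : Set (Space d)), inner ℝ (stateGrad y x) (stateGrad v x)

/-- The norm `‖y‖_{L¹(Ω)} = ∫_Ω |y|`. -/
def normL1 (y : L2 Ω) : ℝ := ∫ x in (Ω : Set (Space d)), |y x|

/-- The pairing `⟨u, v⟩ = ∫_Ω u v` for `u ∈ L²(Ω)` and `v ∈ H₀¹(Ω)`. -/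
def pairing (u : L2 Ω) (v : H01 Ω) : ℝ := ∫ x in (Ω : Set (Space d)), u x * stateFn v x

/-- `y` solves the variational inequality of the second kind with right-hand side `u`:
`a(y, v - y) + ‖v‖_{L¹} - ‖y‖_{L¹} ≥ ⟨u, v - y⟩` for all `v ∈ H₀¹(Ω)`. -/
def SolvesVI (u : L2 Ω) (y : H01 Ω) : Prop :=
  ∀ v : H01 Ω,
    dirichletForm y (v - y) + normL1 (stateFn v) - normL1 (stateFn y) ≥ pairing u (v - y)

/-- `y` solves the regularized equation with parameter `γ` and right-hand side `u`:
`a(y, v) + (2/π) ∫_Ω arctan(γ y) v = ⟨u, v⟩` for all `v ∈ H₀¹(Ω)`. -/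
def SolvesRegularized (γ : ℝ) (u : L2 Ω) (y : H01 Ω) : Prop :=
  ∀ v : H01 Ω,
    dirichletForm y v
      + 2 / Real.pi * ∫ x in (Ω : Set (Space d)), Real.arctan (γ * stateFn y x) * stateFn v x
      = pairing u v

/-- The objective `J(y, u) = ½ ‖y - y_d‖²_{L²} + (ν/2) ‖u - u_d‖²_{L²}`. -/
def objective (yd ud : L2 Ω) (ν : ℝ) (y : H01 Ω) (u : L2 Ω) : ℝ :=
  1 / 2 * ‖stateFn y - yd‖ ^ 2 + ν / 2 * ‖u - ud‖ ^ 2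

/-- The control `u` is a local solution of "minimize `F(y, u)` over all pairs `(y, u)` that satisfy
the state constraint `A u y`": together with a state `y` it is feasible, and its value is minimal
among all feasible pairs with a control in a closed `L²(Ω)`-ball of positive radius around `u`. -/
def IsLocalSolution (A : L2 Ω → H01 Ω → Prop) (F : H01 Ω → L2 Ω → ℝ) (u : L2 Ω) : Prop :=
  ∃ y : H01 Ω, A u y ∧
    ∃ ε > 0, ∀ (u' : L2 Ω) (y' : H01 Ω), A u' y' → ‖u' - u‖ ≤ ε → F y u ≤ F y' u'

/-- Local solutions of the problem (P): minimize `J(y, u)` subject to the variational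
inequality. -/
def IsLocalSolutionP (yd ud : L2 Ω) (ν : ℝ) (u : L2 Ω) : Prop :=
  IsLocalSolution SolvesVI (objective yd ud ν) u

/-- Local solutions of the problem (P_γ): minimize `J(y, u) + ‖u - ubar‖²_{L²}` subject to the
regularized equation. -/
def IsLocalSolutionPγ (yd ud : L2 Ω) (ν : ℝ) (ubar : L2 Ω) (γ : ℝ) (u : L2 Ω) : Prop :=
  IsLocalSolution (SolvesRegularized γ)
    (fun y u => objective yd ud ν y u + ‖u - ubar‖ ^ 2) u

end VIControl

end

open MeasureTheory Filter Topology TopologicalSpace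
open scoped Gradient Distributions

noncomputable section

namespace VIControl

open scoped RealInnerProductSpace

/-! Let `ε` be a radius of local optimality of `ubar` with state `ybar`. For each `γ > 0` the
penalized objective is minimized only over the controls in the closed `ε`-ball around `ubar`;
minimizers `(y_γ, u_γ)` exist by the direct method. Comparison with `(z_γ, ubar)`, where `z_γ` is
the regularized state of `ubar`, gives `J(y_γ, u_γ) + ‖u_γ - ubar‖² ≤ J(z_γ, ubar)`. As `γ → ∞`, the
right side tends to `J(ybar, ubar)`. Along a subsequence, `u_γ` converges weakly and `y_γ` strongly
in `L²` to a pair that is feasible for (P) and in the ball, so that `liminf J(y_γ, u_γ) ≥ J(ybar,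
ubar)`. Hence the penalty tends to zero, which is strong convergence. Once `‖u_γ - ubar‖ < ε`, the
minimizer is interior to the ball and thus a local solution; for the remaining `γ` a global solution
of the regularized problem is used.

The equation and the inequality are linked by `beta_mul_sub_le`: the regularized sign is a
subgradient of `|·|` up to `2/(πγ)`, so regularized states solve the variational inequality up to
`O(1/γ)` (`regularized_approx_VI`). Compactness comes from `poincare` and `rellich`, both derived
from the translation estimate `lintegral_sq_translate_sub_le`. Weak lower semicontinuity always
enters through the tangent bound `two_inner_sub_le`. -/

/-- Sequential weak compactness of bounded sequences in a separable Hilbert space. -/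
lemma exists_subseq_weak_tendsto {H : Type*} [NormedAddCommGroup H] [InnerProductSpace ℝ H]
    [CompleteSpace H] [SeparableSpace H] (x : ℕ → H) (C : ℝ) (hx : ∀ n, ‖x n‖ ≤ C) :
    ∃ (a : H) (k : ℕ → ℕ), StrictMono k ∧
      ∀ w, Tendsto (fun n => ⟪x (k n), w⟫) atTop (𝓝 ⟪a, w⟫) := by
  have hK := WeakDual.isSeqCompact_closedBall ℝ H 0 C
  let f : ℕ → WeakDual ℝ H := fun n => StrongDual.toWeakDual (InnerProductSpace.toDual ℝ H (x n))
  obtain ⟨a, -, k, hk, hlim⟩ := hK (x := f) (fun n => by simpa [f] using hx n)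
  refine ⟨(InnerProductSpace.toDual ℝ H).symm (WeakDual.toStrongDual a), k, hk, fun w => ?_⟩
  have := ((WeakDual.eval_continuous w).tendsto a).comp hlim
  simpa [f, Function.comp_def] using this

/-! ### Hilbert space structure of `H₀¹(Ω)`. -/

variable {d : ℕ} {Ω : Opens (Space d)}

lemma inner_integral_smul_gradient (y : L2 Ω) (φ : 𝓓(Ω, ℝ)) (e : Space d) :
    ⟪e, ∫ x in (Ω : Set (Space d)), y x • ∇ φ x⟫
      = ∫ x in (Ω : Set (Space d)), y x * ⟪e, ∇ φ x⟫ := by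
  rw [← integral_inner (integrable_smul_gradient y φ)]
  simp [inner_smul_right]

lemma inner_integral_test_smul (g : L2Vec Ω) (φ : 𝓓(Ω, ℝ)) (e : Space d) :
    ⟪e, ∫ x in (Ω : Set (Space d)), φ x • g x⟫
      = ∫ x in (Ω : Set (Space d)), ⟪g x, φ x • e⟫ := by
  rw [← integral_inner (integrable_test_smul φ g)]
  simp [inner_smul_right, real_inner_comm]

/-- Pairing the vector identity with each constant vector `e` turns it into equations between `L²`
inner products with fixed elements; each of them cuts out a closed set. -/
lemma isClosed_H1 : IsClosed (H1 Ω : Set (WithLp 2 (L2 Ω × L2Vec Ω))) := by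
  have h1 : ∀ (φ : 𝓓(Ω, ℝ)) (e : Space d),
      MemLp (fun x => ⟪e, ∇ φ x⟫) 2 (volume.restrict (Ω : Set (Space d))) := fun φ e =>
    (((continuous_gradient_test φ).memLp_of_hasCompactSupport
      (hasCompactSupport_gradient_test φ))).const_inner e
  have h2 : ∀ (φ : 𝓓(Ω, ℝ)) (e : Space d),
      MemLp (fun x => φ x • e) 2 (volume.restrict (Ω : Set (Space d))) := fun φ e =>
    (φ.continuous.smul continuous_const).memLp_of_hasCompactSupport φ.hasCompactSupport.smul_right
  have key : (H1 Ω : Set (WithLp 2 (L2 Ω × L2Vec Ω))) = ⋂ (φ : 𝓓(Ω, ℝ)), ⋂ (e : Space d),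
      {p | ⟪p.fst, (h1 φ e).toLp⟫ = - ⟪p.snd, (h2 φ e).toLp⟫} := by
    ext p
    simp only [Set.mem_iInter, Set.mem_ofPred_eq]
    refine forall_congr' fun φ => ?_
    rw [ext_iff_inner_left ℝ]
    refine forall_congr' fun e => ?_
    rw [inner_neg_right, inner_integral_smul_gradient, inner_integral_test_smul, L2.inner_def,
      L2.inner_def]
    have e1 : ∫ x in (Ω : Set (Space d)), p.fst x * ⟪e, ∇ φ x⟫
        = ∫ x in (Ω : Set (Space d)), ⟪p.fst x, (h1 φ e).toLp _ x⟫ := by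
      refine integral_congr_ae ?_
      filter_upwards [(h1 φ e).coeFn_toLp] with x hx
      rw [hx]; simp [mul_comm]
    have e2 : ∫ x in (Ω : Set (Space d)), ⟪p.snd x, φ x • e⟫
        = ∫ x in (Ω : Set (Space d)), ⟪p.snd x, (h2 φ e).toLp _ x⟫ := by
      refine integral_congr_ae ?_
      filter_upwards [(h2 φ e).coeFn_toLp] with x hx
      rw [hx]
    rw [e1, e2]
  rw [key]
  refine isClosed_iInter fun φ => isClosed_iInter fun e => isClosed_eq ?_ ?_
  · exact (WithLp.continuous_fst _ _ _).inner continuous_const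
  · exact ((WithLp.continuous_snd _ _ _).inner continuous_const).neg

instance : CompleteSpace (H1 Ω) := isClosed_H1.completeSpace_coe

instance : CompleteSpace (H01 Ω) := (testH1 Ω).isClosed_topologicalClosure.completeSpace_coe

instance : SeparableSpace (L2 Ω) :=
  haveI : Fact ((2 : ENNReal) ≠ ⊤) := ⟨by simp⟩
  inferInstance

instance : SeparableSpace (H01 Ω) :=
  haveI : Fact ((2 : ENNReal) ≠ ⊤) := ⟨by simp⟩
  haveI : SecondCountableTopology (L2 Ω) := inferInstance
  haveI : SecondCountableTopology (L2Vec Ω) := inferInstance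
  haveI : SecondCountableTopology (WithLp 2 (L2 Ω × L2Vec Ω)) := inferInstance
  inferInstance

/-- The Hilbert space `H₀¹(Ω)`, as a type of its own. -/
def State (Ω : Opens (Space d)) : Type := H01 Ω

instance : NormedAddCommGroup (State Ω) := inferInstanceAs (NormedAddCommGroup (H01 Ω))

instance : InnerProductSpace ℝ (State Ω) := inferInstanceAs (InnerProductSpace ℝ (H01 Ω))

instance : CompleteSpace (State Ω) := inferInstanceAs (CompleteSpace (H01 Ω))

instance : SeparableSpace (State Ω) := inferInstanceAs (SeparableSpace (H01 Ω))

lemma State.inner_def (y v : State Ω) : ⟪y, v⟫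
    = ⟪stateFn (Ω := Ω) y, stateFn (Ω := Ω) v⟫ + ⟪stateGrad (Ω := Ω) y, stateGrad (Ω := Ω) v⟫ :=
  rfl

lemma State.norm_sq (y : State Ω) :
    ‖y‖ ^ 2 = ‖stateFn (Ω := Ω) y‖ ^ 2 + ‖stateGrad (Ω := Ω) y‖ ^ 2 := by
  rw [← real_inner_self_eq_norm_sq, State.inner_def, real_inner_self_eq_norm_sq,
    real_inner_self_eq_norm_sq]

/-- The embedding `H₀¹(Ω) → L²(Ω)`. -/
def stateL (Ω : Opens (Space d)) : State Ω →L[ℝ] L2 Ω :=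
  LinearMap.mkContinuous
    { toFun := fun y => stateFn (Ω := Ω) y
      map_add' := fun _ _ => rfl
      map_smul' := fun _ _ => rfl } 1 fun y => by
    rw [one_mul]
    refine le_of_sq_le_sq ?_ (norm_nonneg _)
    rw [State.norm_sq]
    exact le_add_of_nonneg_right (sq_nonneg _)

/-- The weak gradient `H₀¹(Ω) → L²(Ω; ℝ^d)`. -/
def gradL (Ω : Opens (Space d)) : State Ω →L[ℝ] L2Vec Ω :=
  LinearMap.mkContinuous
    { toFun := fun y => stateGrad (Ω := Ω) y
      map_add' := fun _ _ => rfl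
      map_smul' := fun _ _ => rfl } 1 fun y => by
    rw [one_mul]
    refine le_of_sq_le_sq ?_ (norm_nonneg _)
    rw [State.norm_sq]
    exact le_add_of_nonneg_left (sq_nonneg _)

lemma State.norm_sq_eq (y : State Ω) : ‖y‖ ^ 2 = ‖stateL Ω y‖ ^ 2 + ‖gradL Ω y‖ ^ 2 :=
  State.norm_sq y

lemma norm_stateL_le (y : State Ω) : ‖stateL Ω y‖ ≤ ‖y‖ :=
  le_of_sq_le_sq (by rw [State.norm_sq_eq]; linarith [sq_nonneg ‖gradL Ω y‖]) (norm_nonneg _)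

lemma norm_gradL_le (y : State Ω) : ‖gradL Ω y‖ ≤ ‖y‖ :=
  le_of_sq_le_sq (by rw [State.norm_sq_eq]; linarith [sq_nonneg ‖stateL Ω y‖]) (norm_nonneg _)

lemma dirichletForm_eq (y v : State Ω) :
    dirichletForm (Ω := Ω) y v = ⟪gradL Ω y, gradL Ω v⟫ :=
  (L2.inner_def _ _).symm

lemma pairing_eq (u : L2 Ω) (v : State Ω) : pairing (Ω := Ω) u v = ⟪u, stateL Ω v⟫ := by
  rw [L2.inner_def]
  refine integral_congr_ae (.of_forall fun x => ?_)
  exact mul_comm _ _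

/-! ### Translation estimate and Poincaré inequality. -/

lemma sq_sub_le_integral_gradient {f : Space d → ℝ} (hf : ContDiff ℝ 1 f) (x h : Space d) :
    (f (x + h) - f x) ^ 2 ≤ ∫ s in Set.Ioc (0 : ℝ) 1, ‖h‖ ^ 2 * ‖∇ f (x + s • h)‖ ^ 2 := by
  have hd : Differentiable ℝ f := hf.differentiable (by simp)
  have hg : Continuous (∇ f) := (InnerProductSpace.toDual ℝ (Space d)).symm.continuous.comp
    (hf.continuous_fderiv (by simp))
  have hderiv : ∀ s : ℝ, HasDerivAt (fun s : ℝ => f (x + s • h)) ⟪∇ f (x + s • h), h⟫ s := by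
    intro s
    have h1 : HasDerivAt (fun s : ℝ => x + s • h) h s := by
      simpa using ((hasDerivAt_id s).smul_const h).const_add x
    have h2 := (hd (x + s • h)).hasGradientAt.hasFDerivAt.comp_hasDerivAt s h1
    exact h2.congr_deriv (by simp)
  have hc : Continuous fun s : ℝ => ⟪∇ f (x + s • h), h⟫ := by fun_prop
  have hint : f (x + h) - f x = ∫ s in Set.Ioc (0 : ℝ) 1, ⟪∇ f (x + s • h), h⟫ := by
    rw [← intervalIntegral.integral_of_le zero_le_one,
      intervalIntegral.integral_eq_sub_of_hasDerivAt (fun s _ => hderiv s)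
        (hc.intervalIntegrable _ _)]
    simp
  have : IsProbabilityMeasure (volume.restrict (Set.Ioc (0 : ℝ) 1)) := ⟨by simp⟩
  have hi : ∀ {g : ℝ → ℝ}, Continuous g → IntegrableOn g (Set.Ioc (0 : ℝ) 1) := fun hg =>
    (intervalIntegrable_iff_integrableOn_Ioc_of_le zero_le_one).1 (hg.intervalIntegrable _ _)
  have jensen : (∫ s in Set.Ioc (0 : ℝ) 1, ⟪∇ f (x + s • h), h⟫) ^ 2
      ≤ ∫ s in Set.Ioc (0 : ℝ) 1, ⟪∇ f (x + s • h), h⟫ ^ 2 :=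
    (even_two.convexOn_pow (𝕜 := ℝ)).map_integral_le (continuous_pow 2).continuousOn isClosed_univ
      (.of_forall fun _ => Set.mem_univ _) (hi hc) (hi (hc.pow 2))
  rw [hint]
  refine jensen.trans (integral_mono (hi (hc.pow 2)) (hi (by fun_prop)) fun s => ?_)
  have := abs_real_inner_le_norm (∇ f (x + s • h)) h
  calc ⟪∇ f (x + s • h), h⟫ ^ 2 = |⟪∇ f (x + s • h), h⟫| ^ 2 := (sq_abs _).symm
    _ ≤ (‖∇ f (x + s • h)‖ * ‖h‖) ^ 2 := by gcongr
    _ = _ := by ring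

/-- Integrate the pointwise bound over `x` and exchange the integrals; translation invariance then
removes the dependence on `s`. With extended nonnegative integrals no integrability has to be
checked for the exchange. -/
lemma lintegral_sq_translate_sub_le {f : Space d → ℝ} (hf : ContDiff ℝ 1 f) (h : Space d) :
    ∫⁻ x, ENNReal.ofReal ((f (x + h) - f x) ^ 2)
      ≤ ENNReal.ofReal (‖h‖ ^ 2) * ∫⁻ x, ENNReal.ofReal (‖∇ f x‖ ^ 2) := by
  have hg : Continuous (∇ f) := (InnerProductSpace.toDual ℝ (Space d)).symm.continuous.comp
    (hf.continuous_fderiv (by simp))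
  calc ∫⁻ x, ENNReal.ofReal ((f (x + h) - f x) ^ 2)
      ≤ ∫⁻ x, ∫⁻ s in Set.Ioc (0 : ℝ) 1, ENNReal.ofReal (‖h‖ ^ 2 * ‖∇ f (x + s • h)‖ ^ 2) := by
        refine lintegral_mono fun x => ?_
        rw [← ofReal_integral_eq_lintegral_ofReal _ (.of_forall fun s => by positivity)]
        · exact ENNReal.ofReal_le_ofReal (sq_sub_le_integral_gradient hf x h)
        · refine (intervalIntegrable_iff_integrableOn_Ioc_of_le zero_le_one).1
            (Continuous.intervalIntegrable ?_ _ _)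
          fun_prop
    _ = ∫⁻ s in Set.Ioc (0 : ℝ) 1, ∫⁻ x, ENNReal.ofReal (‖h‖ ^ 2 * ‖∇ f (x + s • h)‖ ^ 2) := by
        refine lintegral_lintegral_swap (Measurable.aemeasurable ?_)
        refine ENNReal.measurable_ofReal.comp (Continuous.measurable ?_)
        fun_prop
    _ = ∫⁻ s in Set.Ioc (0 : ℝ) 1, ENNReal.ofReal (‖h‖ ^ 2)
          * ∫⁻ x, ENNReal.ofReal (‖∇ f x‖ ^ 2) := by
        refine lintegral_congr fun s => ?_
        rw [lintegral_add_right_eq_self (fun x => ENNReal.ofReal (‖h‖ ^ 2 * ‖∇ f x‖ ^ 2)) (s • h)]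
        simp_rw [ENNReal.ofReal_mul (sq_nonneg ‖h‖)]
        rw [lintegral_const_mul' _ _ ENNReal.ofReal_ne_top]
    _ = _ := by simp

lemma integrable_sq_norm_of_compact {E : Type*} [NormedAddCommGroup E] {g : Space d → E}
    (hg : Continuous g) (hs : HasCompactSupport g) : Integrable fun x => ‖g x‖ ^ 2 :=
  (hg.norm.pow 2).integrable_of_hasCompactSupport <| hs.mono fun x hx => by
    contrapose! hx
    simp [Function.notMem_support.1 hx]

lemma test_eq_zero (φ : 𝓓(Ω, ℝ)) {x : Space d} (hx : x ∉ Ω) : φ x = 0 :=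
  image_eq_zero_of_notMem_tsupport fun h => hx (φ.tsupport_subset h)

lemma gradient_test_eq_zero (φ : 𝓓(Ω, ℝ)) {x : Space d} (hx : x ∉ Ω) : ∇ φ x = 0 := by
  have : fderiv ℝ φ x = 0 :=
    fderiv_of_notMem_tsupport ℝ fun h => hx (φ.tsupport_subset h)
  simp [gradient, this]

lemma norm_sq_eq_integral {E : Type*} [NormedAddCommGroup E] [InnerProductSpace ℝ E]
    {μ : Measure (Space d)} (f : Lp E 2 μ) {g : Space d → E} (h : f =ᵐ[μ] g) :
    ‖f‖ ^ 2 = ∫ x, ‖g x‖ ^ 2 ∂μ := by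
  rw [← real_inner_self_eq_norm_sq, L2.inner_def]
  refine integral_congr_ae ?_
  filter_upwards [h] with x hx
  rw [hx, real_inner_self_eq_norm_sq]

lemma ofReal_norm_sq_fst {p : H1 Ω} {φ : 𝓓(Ω, ℝ)}
    (h : p.1.fst =ᵐ[volume.restrict (Ω : Set (Space d))] φ) :
    ENNReal.ofReal (‖p.1.fst‖ ^ 2) = ∫⁻ x, ENNReal.ofReal (φ x ^ 2) := by
  rw [norm_sq_eq_integral _ h,
    setIntegral_eq_integral_of_forall_compl_eq_zero (fun x hx => by
      rw [test_eq_zero φ hx]; simp),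
    ofReal_integral_eq_lintegral_ofReal
      (integrable_sq_norm_of_compact φ.continuous φ.hasCompactSupport)
      (.of_forall fun s => by positivity)]
  simp

lemma ofReal_norm_sq_snd {p : H1 Ω} {φ : 𝓓(Ω, ℝ)}
    (h : p.1.snd =ᵐ[volume.restrict (Ω : Set (Space d))] ∇ φ) :
    ENNReal.ofReal (‖p.1.snd‖ ^ 2) = ∫⁻ x, ENNReal.ofReal (‖∇ φ x‖ ^ 2) := by
  rw [norm_sq_eq_integral _ h,
    setIntegral_eq_integral_of_forall_compl_eq_zero (fun x hx => by
      rw [gradient_test_eq_zero φ hx]; simp),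
    ofReal_integral_eq_lintegral_ofReal
      (integrable_sq_norm_of_compact (continuous_gradient_test φ)
        (hasCompactSupport_gradient_test φ))
      (.of_forall fun s => by positivity)]

/-- A closed property of `H¹` functions that holds for test functions holds on `H₀¹`. -/
lemma H01_mem_of_test {S : Set (H1 Ω)} (hS : IsClosed S) (h : (testH1 Ω : Set (H1 Ω)) ⊆ S)
    (y : H01 Ω) : y.1 ∈ S :=
  closure_minimal h hS y.2

lemma stateL_apply (y : State Ω) : stateL Ω y = (show H01 Ω from y).1.1.fst := rfl

lemma gradL_apply (y : State Ω) : gradL Ω y = (show H01 Ω from y).1.1.snd := rfl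

lemma continuous_H1_fst : Continuous fun p : H1 Ω => p.1.fst :=
  (WithLp.continuous_fst _ _ _).comp continuous_subtype_val

lemma continuous_H1_snd : Continuous fun p : H1 Ω => p.1.snd :=
  (WithLp.continuous_snd _ _ _).comp continuous_subtype_val

lemma poincare_test (hd : 1 ≤ d) {R : ℝ} (hR0 : 0 < R)
    (hR : (Ω : Set (Space d)) ⊆ Metric.ball 0 R) {p : H1 Ω} (hp : p ∈ testH1 Ω) :
    ‖p.1.fst‖ ≤ 2 * R * ‖p.1.snd‖ := by
  obtain ⟨φ, h1, h2⟩ := hp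
  -- A shift by the diameter of the enclosing ball moves every point of `Ω` out of `Ω`, so the
  -- difference `φ (x + h) - φ x` is `-φ x` there. A nonzero shift needs a coordinate, hence `1 ≤
  -- d`.
  obtain ⟨h, hh⟩ : ∃ h : Space d, ‖h‖ = 2 * R :=
    ⟨EuclideanSpace.single ⟨0, hd⟩ (2 * R), by simp [abs_of_pos hR0]⟩
  have hT := lintegral_sq_translate_sub_le (f := φ) (φ.contDiff.of_le (by simp)) h
  have hle : ENNReal.ofReal (‖p.1.fst‖ ^ 2) ≤ ENNReal.ofReal (‖h‖ ^ 2 * ‖p.1.snd‖ ^ 2) := by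
    rw [ENNReal.ofReal_mul (sq_nonneg _), ofReal_norm_sq_fst h1, ofReal_norm_sq_snd h2]
    refine (lintegral_mono fun x => ENNReal.ofReal_le_ofReal ?_).trans hT
    by_cases hx : x ∈ Ω
    · have hxh : x + h ∉ Ω := by
        intro hx'
        have a1 := mem_ball_zero_iff.1 (hR hx)
        have a2 := mem_ball_zero_iff.1 (hR hx')
        have a3 : ‖h‖ ≤ ‖x + h‖ + ‖x‖ := by simpa using norm_sub_le (x + h) x
        linarith
      rw [test_eq_zero φ hxh, zero_sub, neg_sq]
    · rw [test_eq_zero φ hx, sub_zero, zero_pow two_ne_zero]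
      exact sq_nonneg _
  rw [ENNReal.ofReal_le_ofReal_iff (by positivity), hh, ← mul_pow] at hle
  exact le_of_sq_le_sq hle (by positivity)

/-- The Poincaré inequality. -/
lemma poincare (hd : 1 ≤ d) (hΩ : Bornology.IsBounded (Ω : Set (Space d))) :
    ∃ C : ℝ, 0 < C ∧ ∀ y : State Ω, ‖stateL Ω y‖ ≤ C * ‖gradL Ω y‖ := by
  have hb : ∃ R : ℝ, 0 < R ∧ (Ω : Set (Space d)) ⊆ Metric.ball 0 R := hΩ.subset_ball_lt 0 0
  obtain ⟨R, hR0, hR⟩ := hb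
  refine ⟨2 * R, by positivity, fun y => ?_⟩
  have c1 : Continuous fun p : H1 Ω => ‖p.1.fst‖ := continuous_H1_fst.norm
  have c2 : Continuous fun p : H1 Ω => 2 * R * ‖p.1.snd‖ :=
    continuous_H1_snd.norm.const_mul (2 * R)
  have hS : IsClosed {p : H1 Ω | ‖p.1.fst‖ ≤ 2 * R * ‖p.1.snd‖} := isClosed_le c1 c2
  rw [stateL_apply, gradL_apply]
  exact H01_mem_of_test hS (fun p hp => poincare_test hd hR0 hR hp) y

/-! ### Integrals over balls and the Rellich theorem. -/

lemma isFiniteMeasure_restrict (hΩ : Bornology.IsBounded (Ω : Set (Space d))) :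
    IsFiniteMeasure ((volume : Measure (Space d)).restrict (Ω : Set (Space d))) :=
  ⟨by simpa using hΩ.measure_lt_top⟩

/-- The integral of `f ∈ L²(Ω)` over the part of the ball `B(x, r)` in `Ω`. -/
def ballInt (r : ℝ) (x : Space d) (f : L2 Ω) : ℝ :=
  ∫ y in Metric.ball x r, f y ∂((volume : Measure (Space d)).restrict (Ω : Set (Space d)))

lemma stronglyMeasurable_ballInt (r : ℝ) (f : L2 Ω) :
    StronglyMeasurable fun x => ballInt r x f := by
  have h : ∀ x : Space d, ballInt r x f
      = ∫ y in (Ω : Set (Space d)),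
        ({p : Space d × Space d | dist p.2 p.1 < r}.indicator (fun p => f p.2)) (x, y) := by
    intro x
    rw [ballInt, ← integral_indicator measurableSet_ball]
    rfl
  simp_rw [h]
  have hf : StronglyMeasurable fun p : Space d × Space d => (f : Space d → ℝ) p.2 :=
    (Lp.stronglyMeasurable f).comp_measurable measurable_snd
  have hs : MeasurableSet {p : Space d × Space d | dist p.2 p.1 < r} :=
    (isOpen_lt (by fun_prop) continuous_const).measurableSet
  exact (hf.indicator hs).integral_prod_right'

section Finite

variable [IsFiniteMeasure ((volume : Measure (Space d)).restrict (Ω : Set (Space d)))]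

/-- The indicator of `B(x, r)` in `L²(Ω)`. -/
def ballInd (Ω : Opens (Space d))
    [IsFiniteMeasure ((volume : Measure (Space d)).restrict (Ω : Set (Space d)))]
    (r : ℝ) (x : Space d) : L2 Ω :=
  indicatorConstLp 2 (measurableSet_ball (x := x) (ε := r)) (measure_ne_top _ _) (1 : ℝ)

lemma ballInt_eq_inner (r : ℝ) (x : Space d) (f : L2 Ω) : ballInt r x f = ⟪ballInd Ω r x, f⟫ :=
  (L2.inner_indicatorConstLp_one _ _ _).symm

lemma exists_abs_ballInt_le (Ω : Opens (Space d))
    [IsFiniteMeasure ((volume : Measure (Space d)).restrict (Ω : Set (Space d)))] :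
    ∃ K : ℝ, 0 ≤ K ∧ ∀ r x (f : L2 Ω), |ballInt r x f| ≤ K * ‖f‖ := by
  refine ⟨(volume.restrict (Ω : Set (Space d))).real Set.univ ^ (1 / (2 : ℝ)), by positivity,
    fun r x f => ?_⟩
  rw [ballInt_eq_inner]
  refine (abs_real_inner_le_norm _ _).trans (mul_le_mul_of_nonneg_right ?_ (norm_nonneg _))
  rw [ballInd, norm_indicatorConstLp (by simp) (by simp)]
  simp only [norm_one, one_mul, ENNReal.toReal_ofNat]
  exact Real.rpow_le_rpow measureReal_nonneg (measureReal_mono (Set.subset_univ _)) (by norm_num)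

/-- The squared `L²(Ω)` norm of `x ↦ ∫_{B(x, r)} f`. -/
def ballSq (r : ℝ) (f : L2 Ω) : ℝ := ∫ x in (Ω : Set (Space d)), ballInt r x f ^ 2

lemma integrable_ballInt_sq (r : ℝ) (f : L2 Ω) :
    Integrable (fun x => ballInt r x f ^ 2)
      ((volume : Measure (Space d)).restrict (Ω : Set (Space d))) := by
  obtain ⟨K, hK0, hK⟩ := exists_abs_ballInt_le Ω
  refine Integrable.of_bound (C := (K * ‖f‖) ^ 2)
    ((stronglyMeasurable_ballInt r f).pow 2).aestronglyMeasurable (.of_forall fun x => ?_)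
  rw [Real.norm_eq_abs, abs_pow]
  gcongr
  exact hK r x f

/-- Integration over balls is a compact operation: at each `x` it is an inner product with an
indicator, so weak convergence gives pointwise convergence, and the uniform bound `K * C` on a
finite measure space allows dominated convergence. -/
lemma tendsto_ballSq (r : ℝ) {f : ℕ → L2 Ω} {g : L2 Ω} {C : ℝ} (hC : ∀ n, ‖f n‖ ≤ C)
    (h : ∀ b : L2 Ω, Tendsto (fun n => ⟪b, f n⟫) atTop (𝓝 ⟪b, g⟫)) :
    Tendsto (fun n => ballSq r (f n)) atTop (𝓝 (ballSq r g)) := by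
  obtain ⟨K, hK0, hK⟩ := exists_abs_ballInt_le Ω
  refine tendsto_integral_of_dominated_convergence (fun _ => (K * C) ^ 2)
    (fun n => ((stronglyMeasurable_ballInt r (f n)).pow 2).aestronglyMeasurable)
    (integrable_const _) (fun n => .of_forall fun x => ?_) (.of_forall fun x => ?_)
  · rw [Real.norm_eq_abs, abs_pow]
    have h1 := (hK r x (f n)).trans (mul_le_mul_of_nonneg_left (hC n) hK0)
    gcongr
  · simp_rw [ballInt_eq_inner]
    exact (h _).pow 2

lemma continuous_ballSq (r : ℝ) : Continuous (ballSq r : L2 Ω → ℝ) := by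
  refine continuous_iff_seqContinuous.2 fun f g h => ?_
  obtain ⟨C, hC⟩ := (Metric.isBounded_range_of_tendsto f h).exists_norm_le
  exact tendsto_ballSq r (fun n => hC _ ⟨n, rfl⟩) fun b => tendsto_const_nhds.inner h

end Finite

lemma ballInt_test {r : ℝ} {p : H1 Ω} {φ : 𝓓(Ω, ℝ)}
    (h : p.1.fst =ᵐ[volume.restrict (Ω : Set (Space d))] φ) (x : Space d) :
    ballInt r x p.1.fst = ∫ t in Metric.ball (0 : Space d) r, φ (x + t) := by
  have h1 : ballInt r x p.1.fst
      = ∫ y in Metric.ball x r, φ y ∂(volume.restrict (Ω : Set (Space d))) :=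
    integral_congr_ae (ae_restrict_of_ae h)
  have h2 : ∀ t, (Metric.ball (0 : Space d) r).indicator (fun t => φ (x + t)) t
      = (Metric.ball x r).indicator φ (x + t) := fun t => by
    by_cases ht : ‖t‖ < r
    · rw [Set.indicator_of_mem (by simpa using ht), Set.indicator_of_mem (by simpa using ht)]
    · rw [Set.indicator_of_notMem (by simpa using ht),
        Set.indicator_of_notMem (by simpa using ht)]
  have h3 : ∀ y, (Ω : Set (Space d)).indicator ((Metric.ball x r).indicator φ) y
      = (Metric.ball x r).indicator φ y := fun y => by
    by_cases hy : y ∈ (Ω : Set (Space d))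
    · rw [Set.indicator_of_mem hy]
    · rw [Set.indicator_of_notMem hy]
      exact (Set.indicator_apply_eq_zero.2 fun _ => test_eq_zero φ hy).symm
  rw [h1, ← integral_indicator measurableSet_ball, ← integral_indicator measurableSet_ball,
    ← integral_indicator Ω.isOpen.measurableSet]
  simp_rw [h2, h3]
  exact (integral_add_left_eq_self ((Metric.ball x r).indicator φ) x).symm

/-- Bound of a continuous function by its mean over a ball and its mean oscillation. -/
lemma mul_sq_le_ball {f : Space d → ℝ} (hf : Continuous f) {r : ℝ} (hr : 0 < r) (x : Space d) :
    volume.real (Metric.ball (0 : Space d) r) * f x ^ 2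
      ≤ 4 * (volume.real (Metric.ball (0 : Space d) r))⁻¹
          * (∫ t in Metric.ball (0 : Space d) r, f (x + t)) ^ 2
        + ∫ t in Metric.ball (0 : Space d) r, 2 * (f (x + t) - f x) ^ 2 := by
  set c := volume.real (Metric.ball (0 : Space d) r) with hc
  set m := ∫ t in Metric.ball (0 : Space d) r, f (x + t) with hm
  have hc0 : 0 < c :=
    ENNReal.toReal_pos (Metric.measure_ball_pos _ _ hr).ne' measure_ball_lt_top.ne
  have hi : ∀ {g : Space d → ℝ}, Continuous g → IntegrableOn g (Metric.ball (0 : Space d) r) :=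
    fun hg => (hg.continuousOn.integrableOn_compact (isCompact_closedBall 0 r)).mono_set
      Metric.ball_subset_closedBall
  -- Expand the square and drop `2 * f (x + t) ^ 2`; the mixed term left over is absorbed by the
  -- complete square in `h2`.
  have h1 : ∫ t in Metric.ball (0 : Space d) r, (2 * f x ^ 2 - 4 * f x * f (x + t))
      ≤ ∫ t in Metric.ball (0 : Space d) r, 2 * (f (x + t) - f x) ^ 2 := by
    refine integral_mono (hi (by fun_prop)) (hi (by fun_prop)) fun t => ?_
    nlinarith [sq_nonneg (f (x + t))]
  rw [integral_sub (hi (by fun_prop)) (hi (by fun_prop)), integral_const_mul, integral_const_mul,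
    setIntegral_const, ← hc, ← hm, smul_eq_mul] at h1
  have h2 : 0 ≤ c * f x ^ 2 - 4 * f x * m + 4 * c⁻¹ * m ^ 2 := by
    have : c * f x ^ 2 - 4 * f x * m + 4 * c⁻¹ * m ^ 2 = c⁻¹ * (c * f x - 2 * m) ^ 2 := by
      field_simp; ring
    rw [this]; positivity
  linarith

lemma lintegral_ball_oscillation_le {f : Space d → ℝ} (hf : ContDiff ℝ 1 f) (r : ℝ) :
    ∫⁻ x, ∫⁻ t in Metric.ball (0 : Space d) r, ENNReal.ofReal (2 * (f (x + t) - f x) ^ 2)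
      ≤ volume (Metric.ball (0 : Space d) r)
        * (ENNReal.ofReal (2 * r ^ 2) * ∫⁻ x, ENNReal.ofReal (‖∇ f x‖ ^ 2)) := by
  have hc := hf.continuous
  rw [lintegral_lintegral_swap]
  · calc ∫⁻ t in Metric.ball (0 : Space d) r, ∫⁻ x, ENNReal.ofReal (2 * (f (x + t) - f x) ^ 2)
        ≤ ∫⁻ _ in Metric.ball (0 : Space d) r,
          ENNReal.ofReal (2 * r ^ 2) * ∫⁻ x, ENNReal.ofReal (‖∇ f x‖ ^ 2) := by
          refine setLIntegral_mono measurable_const fun t ht => ?_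
          have hr : ‖t‖ ≤ r := (mem_ball_zero_iff.1 ht).le
          simp_rw [ENNReal.ofReal_mul zero_le_two]
          rw [lintegral_const_mul' _ _ ENNReal.ofReal_ne_top, mul_assoc]
          gcongr
          refine (lintegral_sq_translate_sub_le hf t).trans ?_
          gcongr
      _ = _ := by rw [setLIntegral_const, mul_comm]
  · refine Measurable.aemeasurable (ENNReal.measurable_ofReal.comp (Continuous.measurable ?_))
    fun_prop

/-- The quantitative form of Rellich: a term that is continuous under weak convergence, plus a
gradient term that is small with `r`. It follows by integrating `mul_sq_le_ball` over `Ω` and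
bounding the oscillation by the translation estimate. -/
lemma norm_sq_le_ballSq_of_test
    [IsFiniteMeasure ((volume : Measure (Space d)).restrict (Ω : Set (Space d)))]
    {r : ℝ} (hr : 0 < r) {p : H1 Ω} (hp : p ∈ testH1 Ω) :
    ‖p.1.fst‖ ^ 2 ≤ 4 * ((volume.real (Metric.ball (0 : Space d) r))⁻¹) ^ 2 * ballSq r p.1.fst
      + 2 * r ^ 2 * ‖p.1.snd‖ ^ 2 := by
  obtain ⟨φ, h1, h2⟩ := hp
  set c := volume.real (Metric.ball (0 : Space d) r) with hc
  have hc0 : 0 < c :=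
    ENNReal.toReal_pos (Metric.measure_ball_pos _ _ hr).ne' measure_ball_lt_top.ne
  have hφ : Integrable (fun x => φ x ^ 2) (volume.restrict (Ω : Set (Space d))) := by
    simpa using
      (integrable_sq_norm_of_compact φ.continuous φ.hasCompactSupport).restrict (s := Ω)
  have hcv : volume (Metric.ball (0 : Space d) r) = ENNReal.ofReal c :=
    (ENNReal.ofReal_toReal measure_ball_lt_top.ne).symm
  have hb0 : 0 ≤ ballSq r p.1.fst := integral_nonneg fun x => sq_nonneg _
  have key : ENNReal.ofReal (c * ‖p.1.fst‖ ^ 2)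
      ≤ ENNReal.ofReal (4 * c⁻¹ * ballSq r p.1.fst + c * (2 * r ^ 2 * ‖p.1.snd‖ ^ 2)) := by
    calc ENNReal.ofReal (c * ‖p.1.fst‖ ^ 2)
        = ∫⁻ x in (Ω : Set (Space d)), ENNReal.ofReal (c * φ x ^ 2) := by
          rw [← ofReal_integral_eq_lintegral_ofReal (hφ.const_mul c)
            (.of_forall fun s => by positivity), integral_const_mul, norm_sq_eq_integral _ h1]
          simp
      _ ≤ ∫⁻ x in (Ω : Set (Space d)), (ENNReal.ofReal (4 * c⁻¹ * ballInt r x p.1.fst ^ 2)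
          + ∫⁻ t in Metric.ball (0 : Space d) r, ENNReal.ofReal (2 * (φ (x + t) - φ x) ^ 2)) := by
          refine lintegral_mono fun x => ?_
          rw [← ofReal_integral_eq_lintegral_ofReal _ (.of_forall fun s => by positivity),
            ← ENNReal.ofReal_add (by positivity) (integral_nonneg fun t => by positivity),
            ballInt_test h1]
          · exact ENNReal.ofReal_le_ofReal (mul_sq_le_ball φ.continuous hr x)
          · have hcont : Continuous fun t => 2 * (φ (x + t) - φ x) ^ 2 := by
              have := φ.continuous
              fun_prop
            exact (hcont.continuousOn.integrableOn_compact (isCompact_closedBall 0 r)).mono_set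
              Metric.ball_subset_closedBall
      _ = ENNReal.ofReal (4 * c⁻¹ * ballSq r p.1.fst) + ∫⁻ x in (Ω : Set (Space d)),
          ∫⁻ t in Metric.ball (0 : Space d) r, ENNReal.ofReal (2 * (φ (x + t) - φ x) ^ 2) := by
          rw [lintegral_add_left, ballSq, ← integral_const_mul,
            ofReal_integral_eq_lintegral_ofReal ((integrable_ballInt_sq r _).const_mul _)
              (.of_forall fun s => by positivity)]
          exact (((stronglyMeasurable_ballInt r p.1.fst).measurable.pow_const 2).const_mul
            _).ennreal_ofReal
      _ ≤ ENNReal.ofReal (4 * c⁻¹ * ballSq r p.1.fst)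
          + ENNReal.ofReal (c * (2 * r ^ 2 * ‖p.1.snd‖ ^ 2)) := by
          refine add_le_add le_rfl ((setLIntegral_le_lintegral _ _).trans
            ((lintegral_ball_oscillation_le (φ.contDiff.of_le (by simp)) r).trans_eq ?_))
          rw [hcv, ← ofReal_norm_sq_snd h2, ← ENNReal.ofReal_mul (by positivity),
            ← ENNReal.ofReal_mul hc0.le]
      _ = _ := (ENNReal.ofReal_add (by positivity) (by positivity)).symm
  rw [ENNReal.ofReal_le_ofReal_iff (by positivity)] at key
  have h3 : c * ‖p.1.fst‖ ^ 2 ≤ c * (4 * c⁻¹ ^ 2 * ballSq r p.1.fst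
      + 2 * r ^ 2 * ‖p.1.snd‖ ^ 2) := by
    refine key.trans_eq ?_
    field_simp
  exact le_of_mul_le_mul_left h3 hc0

lemma norm_sq_le_ballSq
    [IsFiniteMeasure ((volume : Measure (Space d)).restrict (Ω : Set (Space d)))]
    {r : ℝ} (hr : 0 < r) (y : State Ω) :
    ‖stateL Ω y‖ ^ 2 ≤
      4 * ((volume.real (Metric.ball (0 : Space d) r))⁻¹) ^ 2 * ballSq r (stateL Ω y)
        + 2 * r ^ 2 * ‖gradL Ω y‖ ^ 2 := by
  have c1 : Continuous fun p : H1 Ω => ‖p.1.fst‖ ^ 2 := continuous_H1_fst.norm.pow 2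
  have c2 : Continuous fun p : H1 Ω =>
      4 * ((volume.real (Metric.ball (0 : Space d) r))⁻¹) ^ 2 * ballSq r p.1.fst
        + 2 * r ^ 2 * ‖p.1.snd‖ ^ 2 :=
    (((continuous_ballSq r).comp continuous_H1_fst).const_mul _).add
      ((continuous_H1_snd.norm.pow 2).const_mul _)
  rw [stateL_apply, gradL_apply]
  exact H01_mem_of_test (isClosed_le c1 c2) (fun p hp => norm_sq_le_ballSq_of_test hr hp) y

lemma weak_tendsto_map {H L : Type*} [NormedAddCommGroup H] [InnerProductSpace ℝ H]
    [CompleteSpace H] [NormedAddCommGroup L] [InnerProductSpace ℝ L] [CompleteSpace L]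
    (T : H →L[ℝ] L) {w : ℕ → H} {w' : H}
    (h : ∀ v, Tendsto (fun n => ⟪w n, v⟫) atTop (𝓝 ⟪w', v⟫)) (b : L) :
    Tendsto (fun n => ⟪b, T (w n)⟫) atTop (𝓝 ⟪b, T w'⟫) := by
  simpa only [ContinuousLinearMap.adjoint_inner_right, real_inner_comm b] using h (T.adjoint b)

/-- The Rellich theorem: weakly convergent sequences in `H₀¹(Ω)` converge strongly in `L²(Ω)`. -/
lemma rellich [IsFiniteMeasure ((volume : Measure (Space d)).restrict (Ω : Set (Space d)))]
    {w : ℕ → State Ω} {w' : State Ω} {C : ℝ} (hC : ∀ n, ‖w n‖ ≤ C)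
    (h : ∀ v, Tendsto (fun n => ⟪w n, v⟫) atTop (𝓝 ⟪w', v⟫)) :
    Tendsto (fun n => stateL Ω (w n)) atTop (𝓝 (stateL Ω w')) := by
  have hz : ∀ b : L2 Ω, Tendsto (fun n => ⟪b, stateL Ω (w n - w')⟫) atTop (𝓝 ⟪b, 0⟫) := by
    intro b
    have := (weak_tendsto_map (stateL Ω) h b).sub_const ⟪b, stateL Ω w'⟫
    simp only [← inner_sub_right, ← map_sub, sub_self] at this
    simpa only [inner_zero_right] using this
  have hzC : ∀ n, ‖w n - w'‖ ≤ C + ‖w'‖ := fun n =>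
    (norm_sub_le _ _).trans (add_le_add_left (hC n) _)
  set M := C + ‖w'‖ with hM
  have hT : ∀ n, ‖stateL Ω (w n - w')‖ ≤ M := fun n => (norm_stateL_le _).trans (hzC n)
  have hG : ∀ n, ‖gradL Ω (w n - w')‖ ≤ M := fun n => (norm_gradL_le _).trans (hzC n)
  have hlim : Tendsto (fun n => ‖stateL Ω (w n - w')‖ ^ 2) atTop (𝓝 0) := by
    refine tendsto_order.2 ⟨fun a ha => .of_forall fun n => ha.trans_le (sq_nonneg _),
      fun ε hε => ?_⟩
    -- The radius is fixed first, making the gradient term less than `ε` uniformly in `n`; only then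
    -- `n → ∞` removes the ball term.
    obtain ⟨r, hr0, hr⟩ : ∃ r : ℝ, 0 < r ∧ 2 * r ^ 2 * M ^ 2 < ε := by
      have hcont : Tendsto (fun r : ℝ => 2 * r ^ 2 * M ^ 2) (𝓝[>] 0) (𝓝 0) := by
        have : Continuous fun r : ℝ => 2 * r ^ 2 * M ^ 2 := by fun_prop
        simpa using (this.tendsto 0).mono_left nhdsWithin_le_nhds
      obtain ⟨r, h1, h2⟩ := ((hcont.eventually_lt_const hε).and self_mem_nhdsWithin).exists
      exact ⟨r, h2, h1⟩
    have hQ := (((tendsto_ballSq r hT hz).const_mul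
      (4 * ((volume.real (Metric.ball (0 : Space d) r))⁻¹) ^ 2)).add_const (2 * r ^ 2 * M ^ 2))
    have h0 : ballSq r (0 : L2 Ω) = 0 := by
      have : ∀ x, ballInt r x (0 : L2 Ω) = 0 := fun x => by
        rw [ballInt_eq_inner, inner_zero_right]
      simp [ballSq, this]
    rw [h0, mul_zero, zero_add] at hQ
    filter_upwards [hQ.eventually_lt_const hr] with n hn
    refine ((norm_sq_le_ballSq hr0 (w n - w')).trans ?_).trans_lt hn
    have := hG n
    gcongr
  rw [tendsto_iff_norm_sub_tendsto_zero]
  have := hlim.sqrt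
  simpa only [map_sub, Real.sqrt_sq (norm_nonneg _), Real.sqrt_zero] using this

/-! ### Strongly monotone equations. -/

/-- Strongly monotone Lipschitz maps of a Hilbert space are surjective. -/
lemma exists_eq_of_strongly_monotone {H : Type*} [NormedAddCommGroup H] [InnerProductSpace ℝ H]
    [CompleteSpace H] (F : H → H) {α K : ℝ} (hα : 0 < α)
    (hmono : ∀ x y, α * ‖x - y‖ ^ 2 ≤ ⟪F x - F y, x - y⟫)
    (hlip : ∀ x y, ‖F x - F y‖ ≤ K * ‖x - y‖) (b : H) : ∃ x, F x = b := by
  -- Enlarging the Lipschitz constant ensures `M > 0` and `α ≤ M`, so that `q` below is nonnegative.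
  set M := |K| + α with hM
  have hM0 : 0 < M := by positivity
  have hlipM : ∀ x y, ‖F x - F y‖ ≤ M * ‖x - y‖ := fun x y => (hlip x y).trans
    (mul_le_mul_of_nonneg_right (by linarith [le_abs_self K]) (norm_nonneg _))
  -- This step size minimizes the contraction bound `1 - 2ρα + ρ²M²`, whose minimum is `q`.
  set ρ := α / M ^ 2 with hρ
  have hρ0 : 0 < ρ := by positivity
  let Φ : H → H := fun x => x - ρ • (F x - b)
  set q := 1 - α ^ 2 / M ^ 2 with hq
  have hq1 : q < 1 := by rw [hq]; have : 0 < α ^ 2 / M ^ 2 := by positivity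
                         linarith
  have hq0 : 0 ≤ q := by
    rw [hq, sub_nonneg, div_le_one (by positivity)]
    gcongr
    linarith [abs_nonneg K]
  have hΦ : ∀ x y, ‖Φ x - Φ y‖ ^ 2 ≤ q * ‖x - y‖ ^ 2 := by
    intro x y
    have e : Φ x - Φ y = (x - y) - ρ • (F x - F y) := by
      simp only [Φ]; module
    rw [e, norm_sub_sq_real, inner_smul_right, norm_smul, Real.norm_of_nonneg hρ0.le]
    have h1 := hmono x y
    rw [real_inner_comm] at h1
    have h2 : ‖F x - F y‖ ^ 2 ≤ (M * ‖x - y‖) ^ 2 := by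
      have := hlipM x y
      gcongr
    have h3 : ρ * (α * ‖x - y‖ ^ 2) ≤ ρ * ⟪x - y, F x - F y⟫ := by gcongr
    have h4 : (ρ * ‖F x - F y‖) ^ 2 ≤ ρ ^ 2 * (M * ‖x - y‖) ^ 2 := by
      rw [mul_pow]; gcongr
    have h5 : q * ‖x - y‖ ^ 2 = ‖x - y‖ ^ 2 - 2 * (ρ * (α * ‖x - y‖ ^ 2))
        + ρ ^ 2 * (M * ‖x - y‖) ^ 2 := by
      rw [hq, hρ]; field_simp; ring
    linarith
  have hc : ContractingWith (Real.toNNReal (Real.sqrt q)) Φ := by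
    constructor
    · rw [← NNReal.coe_lt_coe, Real.coe_toNNReal _ (Real.sqrt_nonneg _), NNReal.coe_one,
        Real.sqrt_lt' one_pos]
      simpa using hq1
    · refine LipschitzWith.of_dist_le_mul fun x y => ?_
      rw [dist_eq_norm, dist_eq_norm, Real.coe_toNNReal _ (Real.sqrt_nonneg _)]
      refine le_of_sq_le_sq ?_ (by positivity)
      rw [mul_pow, Real.sq_sqrt hq0]
      exact hΦ x y
  have : Nonempty H := ⟨0⟩
  refine ⟨hc.fixedPoint Φ, ?_⟩
  have h := hc.fixedPoint_isFixedPt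
  have h' : ρ • (F (hc.fixedPoint Φ) - b) = 0 := by
    have : hc.fixedPoint Φ - ρ • (F (hc.fixedPoint Φ) - b) = hc.fixedPoint Φ := h
    simpa using this
  exact sub_eq_zero.1 ((smul_eq_zero.1 h').resolve_left hρ0.ne')

/-! ### The regularized sign and its superposition operator. -/

/-- The regularized sign `t ↦ (2/π) arctan (γ t)`. -/
def beta (γ t : ℝ) : ℝ := 2 / Real.pi * Real.arctan (γ * t)

lemma beta_zero (γ : ℝ) : beta γ 0 = 0 := by simp [beta]

lemma abs_beta_le_one (γ t : ℝ) : |beta γ t| ≤ 1 := by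
  have h : |Real.arctan (γ * t)| ≤ Real.pi / 2 :=
    abs_le.2 ⟨by linarith [Real.neg_pi_div_two_lt_arctan (γ * t)],
      (Real.arctan_lt_pi_div_two _).le⟩
  have hpi := Real.pi_pos
  rw [beta, abs_mul, abs_of_pos (by positivity)]
  calc 2 / Real.pi * |Real.arctan (γ * t)| ≤ 2 / Real.pi * (Real.pi / 2) := by gcongr
    _ = 1 := by field_simp

lemma monotone_beta {γ : ℝ} (hγ : 0 ≤ γ) : Monotone (beta γ) := fun s t h => by
  have hpi := Real.pi_pos
  unfold beta
  gcongr

lemma lipschitzWith_arctan : LipschitzWith 1 Real.arctan := by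
  refine lipschitzWith_of_nnnorm_deriv_le Real.differentiable_arctan fun x => ?_
  rw [Real.deriv_arctan, ← NNReal.coe_le_coe, coe_nnnorm, Real.norm_of_nonneg (by positivity),
    NNReal.coe_one, div_le_one (by positivity)]
  linarith [sq_nonneg x]

lemma lipschitzWith_beta (γ : ℝ) : LipschitzWith (Real.toNNReal (2 / Real.pi * |γ|)) (beta γ) := by
  have hpi := Real.pi_pos
  refine LipschitzWith.of_dist_le_mul fun s t => ?_
  have h := lipschitzWith_arctan.dist_le_mul (γ * s) (γ * t)
  rw [Real.dist_eq, Real.dist_eq, ← mul_sub, abs_mul, NNReal.coe_one, one_mul] at h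
  rw [Real.dist_eq, Real.dist_eq, Real.coe_toNNReal _ (by positivity), beta, beta, ← mul_sub,
    abs_mul, abs_of_pos (by positivity : 0 < 2 / Real.pi), mul_assoc]
  gcongr

/-- For `x > 0`, `arctan x = π/2 - arctan (1/x)` and `arctan (1/x) ≤ 1/x`; negative `x` follow by
oddness. -/
lemma le_mul_arctan (x : ℝ) : Real.pi / 2 * |x| - 1 ≤ x * Real.arctan x := by
  have key : ∀ x : ℝ, 0 < x → Real.pi / 2 * x - 1 ≤ x * Real.arctan x := by
    intro x hx
    have h1 := Real.arctan_inv_of_pos hx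
    have h2 : Real.arctan x⁻¹ ≤ x⁻¹ := by
      have := lipschitzWith_arctan.dist_le_mul x⁻¹ 0
      rw [Real.arctan_zero, Real.dist_0_eq_abs, Real.dist_0_eq_abs, NNReal.coe_one, one_mul,
        abs_of_pos (inv_pos.2 hx)] at this
      exact (le_abs_self _).trans this
    have h3 : x * Real.arctan x⁻¹ ≤ 1 := by
      calc x * Real.arctan x⁻¹ ≤ x * x⁻¹ := by gcongr
        _ = 1 := mul_inv_cancel₀ hx.ne'
    rw [h1] at h3
    linarith
  rcases lt_trichotomy x 0 with hx | rfl | hx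
  · have := key (-x) (by linarith)
    rw [Real.arctan_neg] at this
    rw [abs_of_neg hx]
    linarith
  · simp
  · rw [abs_of_pos hx]
    exact key x hx

lemma abs_sub_le_beta_mul {γ : ℝ} (hγ : 0 < γ) (s : ℝ) :
    |s| - 2 / Real.pi / γ ≤ beta γ s * s := by
  have hpi := Real.pi_pos
  have h := le_mul_arctan (γ * s)
  rw [abs_mul, abs_of_pos hγ] at h
  have h2 := mul_le_mul_of_nonneg_left h (by positivity : 0 ≤ 2 / Real.pi / γ)
  rw [beta]
  calc |s| - 2 / Real.pi / γ = 2 / Real.pi / γ * (Real.pi / 2 * (γ * |s|) - 1) := by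
        field_simp
    _ ≤ 2 / Real.pi / γ * (γ * s * Real.arctan (γ * s)) := h2
    _ = _ := by field_simp

/-- An approximate subgradient inequality for the absolute value: `|beta γ s| ≤ 1` controls the `t`
part, and `beta γ s * s` falls short of `|s|` by at most the error term. -/
lemma beta_mul_sub_le {γ : ℝ} (hγ : 0 < γ) (s t : ℝ) :
    beta γ s * (t - s) ≤ |t| - |s| + 2 / Real.pi / γ := by
  have h1 := abs_sub_le_beta_mul hγ s
  have h2 : beta γ s * t ≤ |t| := by
    calc beta γ s * t ≤ |beta γ s| * |t| := by rw [← abs_mul]; exact le_abs_self _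
      _ ≤ 1 * |t| := by gcongr; exact abs_beta_le_one _ _
      _ = |t| := one_mul _
  linarith

/-- The superposition operator of `beta γ` on `L²(Ω)`. -/
def betaL (γ : ℝ) (y : L2 Ω) : L2 Ω := (lipschitzWith_beta γ).compLp (beta_zero γ) y

lemma coeFn_betaL (γ : ℝ) (y : L2 Ω) :
    betaL γ y =ᵐ[volume.restrict (Ω : Set (Space d))] fun x => beta γ (y x) :=
  (lipschitzWith_beta γ).coeFn_compLp (beta_zero γ) y

lemma lipschitzWith_betaL (γ : ℝ) :
    LipschitzWith (Real.toNNReal (2 / Real.pi * |γ|)) (betaL γ : L2 Ω → L2 Ω) :=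
  (lipschitzWith_beta γ).lipschitzWith_compLp (beta_zero γ)

lemma inner_betaL (γ : ℝ) (y v : L2 Ω) :
    ⟪betaL γ y, v⟫ = ∫ x in (Ω : Set (Space d)), beta γ (y x) * v x := by
  rw [L2.inner_def]
  refine integral_congr_ae ?_
  filter_upwards [coeFn_betaL γ y] with x hx
  rw [hx]
  exact mul_comm _ _

lemma betaL_monotone {γ : ℝ} (hγ : 0 ≤ γ) (y z : L2 Ω) : 0 ≤ ⟪betaL γ y - betaL γ z, y - z⟫ := by
  rw [L2.inner_def]
  refine integral_nonneg_of_ae ?_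
  filter_upwards [coeFn_betaL γ y, coeFn_betaL γ z, Lp.coeFn_sub (betaL γ y) (betaL γ z),
    Lp.coeFn_sub y z] with x h1 h2 h3 h4
  rw [h3, h4, Pi.sub_apply, Pi.sub_apply, h1, h2]
  change 0 ≤ (y x - z x) * (beta γ (y x) - beta γ (z x))
  rcases le_total (y x) (z x) with h | h
  · exact mul_nonneg_of_nonpos_of_nonpos (sub_nonpos.2 h) (sub_nonpos.2 (monotone_beta hγ h))
  · exact mul_nonneg (sub_nonneg.2 h) (sub_nonneg.2 (monotone_beta hγ h))

section Finite

variable [IsFiniteMeasure ((volume : Measure (Space d)).restrict (Ω : Set (Space d)))]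

lemma integrable_abs_L2 (y : L2 Ω) :
    Integrable (fun x => |y x|) ((volume : Measure (Space d)).restrict (Ω : Set (Space d))) :=
  ((Lp.memLp y).integrable (by norm_num)).abs

lemma continuous_normL1 : Continuous (normL1 : L2 Ω → ℝ) := by
  have h : ∀ y : L2 Ω, normL1 y = ⟪Lp.const 2 (volume.restrict (Ω : Set (Space d))) (1 : ℝ),
      (lipschitzWith_one_norm (E := ℝ)).compLp norm_zero y⟫ := by
    intro y
    rw [L2.inner_def]
    refine integral_congr_ae ?_
    filter_upwards [(lipschitzWith_one_norm (E := ℝ)).coeFn_compLp norm_zero y,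
      Lp.coeFn_const (p := 2) (μ := volume.restrict (Ω : Set (Space d))) (1 : ℝ)] with x h1 h2
    rw [h1, h2]
    simp
  simp_rw [funext h]
  exact continuous_const.inner
    ((lipschitzWith_one_norm (E := ℝ)).lipschitzWith_compLp norm_zero).continuous

lemma inner_betaL_sub_le {γ : ℝ} (hγ : 0 < γ) (y v : L2 Ω) :
    ⟪betaL γ y, v - y⟫ ≤ normL1 v - normL1 y
      + 2 / Real.pi * volume.real (Ω : Set (Space d)) / γ := by
  have hc : ∫ _ in (Ω : Set (Space d)), 2 / Real.pi / γ
      = 2 / Real.pi * volume.real (Ω : Set (Space d)) / γ := by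
    rw [setIntegral_const, smul_eq_mul]; ring
  have hi : Integrable (fun x => |v x| - |y x|) (volume.restrict (Ω : Set (Space d))) :=
    (integrable_abs_L2 v).sub (integrable_abs_L2 y)
  rw [normL1, normL1, ← integral_sub (integrable_abs_L2 v) (integrable_abs_L2 y), ← hc,
    ← integral_add hi (integrable_const _),
    L2.inner_def]
  refine integral_mono_ae (L2.integrable_inner _ _)
    (hi.add (integrable_const _)) ?_
  filter_upwards [coeFn_betaL γ y, Lp.coeFn_sub v y] with x h1 h2
  rw [h1, h2, Pi.sub_apply]
  exact (mul_comm _ _).trans_le (beta_mul_sub_le hγ (y x) (v x))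

end Finite

/-! ### Operator form of the constraints and solvability of the regularized equation. -/

lemma solvesRegularized_iff (γ : ℝ) (u : L2 Ω) (y : State Ω) :
    SolvesRegularized (Ω := Ω) γ u y ↔
      ∀ v : State Ω, ⟪gradL Ω y, gradL Ω v⟫ + ⟪betaL γ (stateL Ω y), stateL Ω v⟫
        = ⟪u, stateL Ω v⟫ := by
  refine forall_congr' fun v => ?_
  rw [dirichletForm_eq y v, pairing_eq u v, inner_betaL, ← integral_const_mul]
  simp only [beta, mul_assoc]
  rfl

lemma solvesVI_iff (u : L2 Ω) (y : State Ω) :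
    SolvesVI (Ω := Ω) u y ↔
      ∀ v : State Ω, ⟪u, stateL Ω (v - y)⟫ ≤
        ⟪gradL Ω y, gradL Ω (v - y)⟫ + normL1 (stateL Ω v) - normL1 (stateL Ω y) := by
  refine forall_congr' fun v : State Ω => ?_
  rw [← dirichletForm_eq y (v - y), ← pairing_eq u (v - y)]
  rfl

/-- Solvability of the regularized equation. -/
lemma exists_solvesRegularized {C : ℝ}
    (hP : ∀ y : State Ω, ‖stateL Ω y‖ ≤ C * ‖gradL Ω y‖) {γ : ℝ} (hγ : 0 ≤ γ) (u : L2 Ω) :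
    ∃ y : State Ω, SolvesRegularized (Ω := Ω) γ u y := by
  -- With the Hilbert adjoints of gradient and embedding, the weak equation reads `F y = (stateL
  -- Ω).adjoint u`.
  let F : State Ω → State Ω := fun y =>
    (gradL Ω).adjoint (gradL Ω y) + (stateL Ω).adjoint (betaL γ (stateL Ω y))
  have hF : ∀ y v, ⟪F y, v⟫ = ⟪gradL Ω y, gradL Ω v⟫ + ⟪betaL γ (stateL Ω y), stateL Ω v⟫ :=
    fun y v => by
      simp only [F, inner_add_left, ContinuousLinearMap.adjoint_inner_left]
  have hFs : ∀ x y v, ⟪F x - F y, v⟫ = ⟪gradL Ω (x - y), gradL Ω v⟫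
      + ⟪betaL γ (stateL Ω x) - betaL γ (stateL Ω y), stateL Ω v⟫ := fun x y v => by
    rw [inner_sub_left, hF, hF, map_sub, inner_sub_left, inner_sub_left]; ring
  set K := 2 / Real.pi * |γ| with hK
  have hK0 : 0 ≤ K := by have := Real.pi_pos; positivity
  -- The term with `betaL` is nonnegative by monotonicity; the Poincaré inequality makes the
  -- gradient term coercive in the full norm.
  have hmono : ∀ x y, (C ^ 2 + 1)⁻¹ * ‖x - y‖ ^ 2 ≤ ⟪F x - F y, x - y⟫ := by
    intro x y
    rw [hFs, real_inner_self_eq_norm_sq]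
    have h1 := betaL_monotone hγ (stateL Ω x) (stateL Ω y)
    rw [← map_sub] at h1
    have h2 : ‖x - y‖ ^ 2 ≤ (C ^ 2 + 1) * ‖gradL Ω (x - y)‖ ^ 2 := by
      have h3 : ‖stateL Ω (x - y)‖ ^ 2 ≤ (C * ‖gradL Ω (x - y)‖) ^ 2 := by
        have := hP (x - y)
        gcongr
      rw [State.norm_sq_eq]
      linarith
    have h4 : (C ^ 2 + 1)⁻¹ * ‖x - y‖ ^ 2 ≤ ‖gradL Ω (x - y)‖ ^ 2 := by
      rw [inv_mul_le_iff₀ (by positivity)]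
      exact h2
    linarith
  have hlip : ∀ x y, ‖F x - F y‖ ≤ (1 + K) * ‖x - y‖ := by
    intro x y
    have h0 : ‖betaL γ (stateL Ω x) - betaL γ (stateL Ω y)‖ ≤ K * ‖x - y‖ := by
      have h := (lipschitzWith_betaL γ).dist_le_mul (stateL Ω x) (stateL Ω y)
      rw [dist_eq_norm, dist_eq_norm, Real.coe_toNNReal _ hK0, ← map_sub] at h
      exact h.trans (mul_le_mul_of_nonneg_left (norm_stateL_le _) hK0)
    set w := F x - F y with hw
    -- The norm of `w` is estimated by testing with `w` itself and dividing.
    have h1 : ‖w‖ * ‖w‖ ≤ ((1 + K) * ‖x - y‖) * ‖w‖ := by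
      rw [← real_inner_self_eq_norm_mul_norm]
      nth_rw 1 [hw]
      rw [hFs]
      have h2 : ⟪gradL Ω (x - y), gradL Ω w⟫ ≤ ‖x - y‖ * ‖w‖ :=
        (real_inner_le_norm _ _).trans
          (mul_le_mul (norm_gradL_le _) (norm_gradL_le _) (norm_nonneg _) (norm_nonneg _))
      have h3 : ⟪betaL γ (stateL Ω x) - betaL γ (stateL Ω y), stateL Ω w⟫
          ≤ K * ‖x - y‖ * ‖w‖ :=
        (real_inner_le_norm _ _).trans
          (mul_le_mul h0 (norm_stateL_le _) (norm_nonneg _) (by positivity))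
      linarith
    rcases (norm_nonneg w).eq_or_lt with h | h
    · rw [← h]; positivity
    · exact le_of_mul_le_mul_right h1 h
  obtain ⟨y, hy⟩ := exists_eq_of_strongly_monotone F (by positivity) hmono hlip
    ((stateL Ω).adjoint u)
  refine ⟨y, (solvesRegularized_iff γ u y).2 fun v => ?_⟩
  rw [← hF, hy, ContinuousLinearMap.adjoint_inner_left]

/-! ### Weak limits and stability of the regularized equation. -/

section Weak

variable {H : Type*} [NormedAddCommGroup H] [InnerProductSpace ℝ H]

lemma weak_strong_inner_tendsto {x b : ℕ → H} {x' b' : H} {M : ℝ} (hM : ∀ n, ‖x n‖ ≤ M)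
    (h : ∀ w, Tendsto (fun n => ⟪x n, w⟫) atTop (𝓝 ⟪x', w⟫)) (hb : Tendsto b atTop (𝓝 b')) :
    Tendsto (fun n => ⟪x n, b n⟫) atTop (𝓝 ⟪x', b'⟫) := by
  have h0 : Tendsto (fun n => ⟪x n, b n - b'⟫) atTop (𝓝 0) := by
    refine squeeze_zero_norm (a := fun n => M * ‖b n - b'‖) (fun n => ?_) ?_
    · exact (abs_real_inner_le_norm _ _).trans
        (mul_le_mul_of_nonneg_right (hM n) (norm_nonneg _))
    · simpa using (tendsto_iff_norm_sub_tendsto_zero.1 hb).const_mul M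
  simpa [inner_sub_right] using h0.add (h b')

lemma norm_sub_le_of_weak_tendsto {x : ℕ → H} {x' a : H} {R : ℝ} (hR : ∀ n, ‖x n - a‖ ≤ R)
    (h : ∀ w, Tendsto (fun n => ⟪x n, w⟫) atTop (𝓝 ⟪x', w⟫)) : ‖x' - a‖ ≤ R := by
  have h1 : Tendsto (fun n => ⟪x n - a, x' - a⟫) atTop (𝓝 ⟪x' - a, x' - a⟫) := by
    simpa only [inner_sub_left] using (h (x' - a)).sub_const ⟪a, x' - a⟫
  have h2 : ⟪x' - a, x' - a⟫ ≤ R * ‖x' - a‖ := le_of_tendsto' h1 fun n =>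
    (real_inner_le_norm _ _).trans (mul_le_mul_of_nonneg_right (hR n) (norm_nonneg _))
  rw [real_inner_self_eq_norm_mul_norm] at h2
  rcases (norm_nonneg (x' - a)).eq_or_lt with h3 | h3
  · rw [← h3]; exact (norm_nonneg _).trans (hR 0)
  · exact le_of_mul_le_mul_right h2 h3

/-- The left side is affine in `x` and equals `‖y‖ ^ 2` at `x = y`. It passes to weak limits, and
with `y` the weak limit it replaces lower semicontinuity of the norm. -/
lemma two_inner_sub_le (x y : H) : 2 * ⟪x, y⟫ - ‖y‖ ^ 2 ≤ ‖x‖ ^ 2 := by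
  have := norm_sub_sq_real x y
  nlinarith [sq_nonneg ‖x - y‖]

end Weak

/-- Test with `y`: the nonlinear term has a sign since `beta γ 0 = 0`. The bound does not depend on
`γ`, as needed for `γ → ∞`. -/
lemma norm_le_of_solvesRegularized {C : ℝ} (hC : 0 < C)
    (hP : ∀ y : State Ω, ‖stateL Ω y‖ ≤ C * ‖gradL Ω y‖) {γ : ℝ} (hγ : 0 ≤ γ) {u : L2 Ω}
    {y : State Ω} (hy : SolvesRegularized (Ω := Ω) γ u y) : ‖y‖ ≤ (C + 1) * (C * ‖u‖) := by
  have h1 := (solvesRegularized_iff γ u y).1 hy y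
  have h2 := betaL_monotone hγ (stateL Ω y) 0
  have h0 : betaL γ (0 : L2 Ω) = 0 := (lipschitzWith_beta γ).compLp_zero (beta_zero γ)
  rw [h0, sub_zero, sub_zero] at h2
  rw [real_inner_self_eq_norm_mul_norm] at h1
  have h3 : ⟪u, stateL Ω y⟫ ≤ ‖u‖ * (C * ‖gradL Ω y‖) :=
    (real_inner_le_norm _ _).trans (mul_le_mul_of_nonneg_left (hP y) (norm_nonneg _))
  have hG : ‖gradL Ω y‖ ≤ C * ‖u‖ := by
    rcases (norm_nonneg (gradL Ω y)).eq_or_lt with h | h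
    · rw [← h]; positivity
    · exact le_of_mul_le_mul_right (by linarith) h
  have h4 : ‖y‖ ≤ (C + 1) * ‖gradL Ω y‖ := by
    refine le_of_sq_le_sq ?_ (by positivity)
    rw [State.norm_sq_eq]
    have h5 : ‖stateL Ω y‖ ^ 2 ≤ (C * ‖gradL Ω y‖) ^ 2 := by
      have := hP y
      gcongr
    nlinarith [mul_nonneg hC.le (sq_nonneg ‖gradL Ω y‖)]
  exact h4.trans (mul_le_mul_of_nonneg_left hG (by positivity))

lemma solvesRegularized_of_tendsto {γ : ℝ} {u : ℕ → L2 Ω} {y : ℕ → State Ω} {u' : L2 Ω}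
    {y' : State Ω} (hy : ∀ n, SolvesRegularized (Ω := Ω) γ (u n) (y n))
    (hu : ∀ w, Tendsto (fun n => ⟪u n, w⟫) atTop (𝓝 ⟪u', w⟫))
    (hG : ∀ w, Tendsto (fun n => ⟪gradL Ω (y n), w⟫) atTop (𝓝 ⟪gradL Ω y', w⟫))
    (hT : Tendsto (fun n => stateL Ω (y n)) atTop (𝓝 (stateL Ω y'))) :
    SolvesRegularized (Ω := Ω) γ u' y' := by
  refine (solvesRegularized_iff γ u' y').2 fun v => ?_
  have h1 := (hG (gradL Ω v)).add
    ((((lipschitzWith_betaL γ).continuous.tendsto _).comp hT).inner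
      (tendsto_const_nhds (x := stateL Ω v)))
  refine tendsto_nhds_unique (h1.congr fun n => ?_) (hu (stateL Ω v))
  exact (solvesRegularized_iff γ (u n) (y n)).1 (hy n) v

/-! ### Lower semicontinuity of the objective. -/

variable (yd ud : L2 Ω) (ν : ℝ)

lemma objective_eq (y : State Ω) (u : L2 Ω) :
    objective (Ω := Ω) yd ud ν y u = 1 / 2 * ‖stateL Ω y - yd‖ ^ 2 + ν / 2 * ‖u - ud‖ ^ 2 := rfl

lemma objective_nonneg (hν : 0 ≤ ν) (y : State Ω) (u : L2 Ω) :
    0 ≤ objective (Ω := Ω) yd ud ν y u := by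
  rw [objective_eq]; positivity

/-- The lower bound of the objective obtained by linearizing the control cost at `u'`. -/
def objectiveLower (u' : L2 Ω) (y : State Ω) (u : L2 Ω) : ℝ :=
  1 / 2 * ‖stateL Ω y - yd‖ ^ 2 + ν / 2 * (2 * ⟪u - ud, u' - ud⟫ - ‖u' - ud‖ ^ 2)

lemma objectiveLower_le (hν : 0 ≤ ν) (u' : L2 Ω) (y : State Ω) (u : L2 Ω) :
    objectiveLower yd ud ν u' y u ≤ objective (Ω := Ω) yd ud ν y u := by
  rw [objectiveLower, objective_eq]
  have := two_inner_sub_le (u - ud) (u' - ud)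
  gcongr

/-- The linearization is exact at `u'`, so under weak convergence of the controls the lower bound
converges to the full objective of the limit pair. -/
lemma tendsto_objectiveLower {u : ℕ → L2 Ω} {y : ℕ → State Ω} {u' : L2 Ω} {y' : State Ω}
    (hu : ∀ w, Tendsto (fun n => ⟪u n, w⟫) atTop (𝓝 ⟪u', w⟫))
    (hT : Tendsto (fun n => stateL Ω (y n)) atTop (𝓝 (stateL Ω y'))) :
    Tendsto (fun n => objectiveLower yd ud ν u' (y n) (u n)) atTop
      (𝓝 (objective (Ω := Ω) yd ud ν y' u')) := by
  have h1 : Tendsto (fun n => ⟪u n - ud, u' - ud⟫) atTop (𝓝 ⟪u' - ud, u' - ud⟫) := by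
    simpa only [inner_sub_left] using (hu (u' - ud)).sub_const ⟪ud, u' - ud⟫
  have h2 := ((((hT.sub_const yd).norm.pow 2).const_mul (1 / 2)).add
    (((h1.const_mul 2).sub_const (‖u' - ud‖ ^ 2)).const_mul (ν / 2)))
  have e : objective (Ω := Ω) yd ud ν y' u' = 1 / 2 * ‖stateL Ω y' - yd‖ ^ 2
      + ν / 2 * (2 * ⟪u' - ud, u' - ud⟫ - ‖u' - ud‖ ^ 2) := by
    rw [objective_eq, real_inner_self_eq_norm_sq]; ring
  rw [e]
  exact h2

/-! ### Limit `γ → ∞`, existence and convergence of minimizers. -/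

section Finite

variable [IsFiniteMeasure ((volume : Measure (Space d)).restrict (Ω : Set (Space d)))]

/-- Bounded controls and their regularized states have convergent subsequences. -/
lemma exists_subseq_control_state {C : ℝ} (hC : 0 < C)
    (hP : ∀ y : State Ω, ‖stateL Ω y‖ ≤ C * ‖gradL Ω y‖) {γ : ℕ → ℝ} (hγ : ∀ n, 0 ≤ γ n)
    {u : ℕ → L2 Ω} {y : ℕ → State Ω} (hy : ∀ n, SolvesRegularized (Ω := Ω) (γ n) (u n) (y n))
    {M : ℝ} (hM : ∀ n, ‖u n‖ ≤ M) :
    ∃ (k : ℕ → ℕ) (u' : L2 Ω) (y' : State Ω), StrictMono k ∧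
      (∀ w, Tendsto (fun n => ⟪u (k n), w⟫) atTop (𝓝 ⟪u', w⟫)) ∧
      (∀ w, Tendsto (fun n => ⟪gradL Ω (y (k n)), w⟫) atTop (𝓝 ⟪gradL Ω y', w⟫)) ∧
      Tendsto (fun n => stateL Ω (y (k n))) atTop (𝓝 (stateL Ω y')) := by
  have hyM : ∀ n, ‖y n‖ ≤ (C + 1) * (C * M) := fun n =>
    (norm_le_of_solvesRegularized hC hP (hγ n) (hy n)).trans
      (mul_le_mul_of_nonneg_left (mul_le_mul_of_nonneg_left (hM n) hC.le) (by positivity))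
  obtain ⟨u', k, hk, hu⟩ := exists_subseq_weak_tendsto u M hM
  obtain ⟨y', l, hl, hy'⟩ := exists_subseq_weak_tendsto (fun n => y (k n)) _ fun n => hyM (k n)
  refine ⟨k ∘ l, u', y', hk.comp hl, fun w => (hu w).comp hl.tendsto_atTop, fun w => ?_,
    rellich (fun n => hyM _) hy'⟩
  simpa only [real_inner_comm w, Function.comp_apply] using weak_tendsto_map (gradL Ω) hy' w

lemma regularized_approx_VI {γ : ℝ} (hγ : 0 < γ) {u : L2 Ω} {y : State Ω}
    (hy : SolvesRegularized (Ω := Ω) γ u y) (v : State Ω) :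
    ⟪u, stateL Ω (v - y)⟫ ≤ ⟪gradL Ω y, gradL Ω (v - y)⟫ + normL1 (stateL Ω v)
      - normL1 (stateL Ω y) + 2 / Real.pi * volume.real (Ω : Set (Space d)) / γ := by
  have h1 := (solvesRegularized_iff γ u y).1 hy (v - y)
  have h2 := inner_betaL_sub_le hγ (stateL Ω y) (stateL Ω v)
  rw [← map_sub] at h2
  linarith

/-- Gradients converge only weakly, so `-‖∇y_n‖²` in the approximate inequality is first replaced by
its affine upper bound at the limit gradient. All terms then converge, and the error is of order
`1/γ`. -/
lemma solvesVI_of_tendsto {γ : ℕ → ℝ} (hγ : ∀ n, 0 < γ n) (hγ' : Tendsto γ atTop atTop)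
    {u : ℕ → L2 Ω} {y : ℕ → State Ω} {u' : L2 Ω} {y' : State Ω} {M : ℝ} (hM : ∀ n, ‖u n‖ ≤ M)
    (hy : ∀ n, SolvesRegularized (Ω := Ω) (γ n) (u n) (y n))
    (hu : ∀ w, Tendsto (fun n => ⟪u n, w⟫) atTop (𝓝 ⟪u', w⟫))
    (hG : ∀ w, Tendsto (fun n => ⟪gradL Ω (y n), w⟫) atTop (𝓝 ⟪gradL Ω y', w⟫))
    (hT : Tendsto (fun n => stateL Ω (y n)) atTop (𝓝 (stateL Ω y'))) :
    SolvesVI (Ω := Ω) u' y' := by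
  refine (solvesVI_iff u' y').2 fun v => ?_
  set D := 2 / Real.pi * volume.real (Ω : Set (Space d)) with hD
  have hl : Tendsto (fun n => ⟪u n, stateL Ω v - stateL Ω (y n)⟫) atTop
      (𝓝 ⟪u', stateL Ω v - stateL Ω y'⟫) :=
    weak_strong_inner_tendsto hM hu (tendsto_const_nhds.sub hT)
  have hr : Tendsto (fun n => ⟪gradL Ω (y n), gradL Ω v⟫
      - (2 * ⟪gradL Ω (y n), gradL Ω y'⟫ - ‖gradL Ω y'‖ ^ 2) + normL1 (stateL Ω v)
      - normL1 (stateL Ω (y n)) + D / γ n) atTop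
      (𝓝 (⟪gradL Ω y', gradL Ω v⟫
      - (2 * ⟪gradL Ω y', gradL Ω y'⟫ - ‖gradL Ω y'‖ ^ 2) + normL1 (stateL Ω v)
      - normL1 (stateL Ω y') + 0)) :=
    (((((hG _).sub (((hG _).const_mul 2).sub_const _)).add_const _).sub
      ((continuous_normL1.tendsto _).comp hT)).add (hγ'.const_div_atTop D))
  have hle := le_of_tendsto_of_tendsto' hl hr fun n => by
    have h1 := regularized_approx_VI (hγ n) (hy n) v
    have h2 := two_inner_sub_le (gradL Ω (y n)) (gradL Ω y')
    rw [map_sub, map_sub, inner_sub_right (gradL Ω (y n)), real_inner_self_eq_norm_sq] at h1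
    linarith
  rw [real_inner_self_eq_norm_sq] at hle
  rw [map_sub, map_sub, inner_sub_right (gradL Ω y'), real_inner_self_eq_norm_sq]
  linarith

/-- Regularized states converge to the solution of the variational inequality at rate `γ⁻¹ᐟ²`. -/
lemma norm_sub_sq_le_of_solvesVI {C : ℝ} (hP : ∀ y : State Ω, ‖stateL Ω y‖ ≤ C * ‖gradL Ω y‖)
    {γ : ℝ} (hγ : 0 < γ) {u : L2 Ω} {y z : State Ω} (hy : SolvesRegularized (Ω := Ω) γ u y)
    (hz : SolvesVI (Ω := Ω) u z) :
    ‖stateL Ω y - stateL Ω z‖ ^ 2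
      ≤ C ^ 2 * (2 / Real.pi * volume.real (Ω : Set (Space d)) / γ) := by
  have h1 := regularized_approx_VI hγ hy z
  -- Each of the two inequalities is tested with the other's solution; in the sum the `L¹` norms and
  -- the control terms cancel.
  have h2 := (solvesVI_iff u z).1 hz y
  have h3 : ‖gradL Ω (y - z)‖ ^ 2 ≤ 2 / Real.pi * volume.real (Ω : Set (Space d)) / γ := by
    rw [← real_inner_self_eq_norm_sq]
    simp only [map_sub, inner_sub_left, inner_sub_right] at h1 h2 ⊢
    linarith
  rw [← map_sub]
  calc ‖stateL Ω (y - z)‖ ^ 2 ≤ (C * ‖gradL Ω (y - z)‖) ^ 2 := by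
        have := hP (y - z)
        gcongr
    _ = C ^ 2 * ‖gradL Ω (y - z)‖ ^ 2 := mul_pow _ _ _
    _ ≤ _ := by gcongr

/-- Minimizers of the penalized regularized problem over a closed ball of controls. -/
lemma exists_minimizer_on_ball (hν : 0 ≤ ν) {C : ℝ} (hC : 0 < C)
    (hP : ∀ y : State Ω, ‖stateL Ω y‖ ≤ C * ‖gradL Ω y‖) {γ : ℝ} (hγ : 0 ≤ γ) (a : L2 Ω) {R : ℝ}
    (hR : 0 ≤ R) :
    ∃ (u : L2 Ω) (y : State Ω), SolvesRegularized (Ω := Ω) γ u y ∧ ‖u - a‖ ≤ R ∧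
      ∀ (u' : L2 Ω) (y' : State Ω), SolvesRegularized (Ω := Ω) γ u' y' → ‖u' - a‖ ≤ R →
        objective (Ω := Ω) yd ud ν y u + ‖u - a‖ ^ 2
          ≤ objective (Ω := Ω) yd ud ν y' u' + ‖u' - a‖ ^ 2 := by
  let S : Set ℝ := {m | ∃ (u : L2 Ω) (y : State Ω), SolvesRegularized (Ω := Ω) γ u y ∧
    ‖u - a‖ ≤ R ∧ m = objective (Ω := Ω) yd ud ν y u + ‖u - a‖ ^ 2}
  have hne : S.Nonempty := by
    obtain ⟨y, hy⟩ := exists_solvesRegularized hP hγ a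
    exact ⟨_, a, y, hy, by simpa using hR, rfl⟩
  have hbdd : BddBelow S := by
    refine ⟨0, ?_⟩
    rintro m ⟨u, y, -, -, rfl⟩
    exact add_nonneg (objective_nonneg yd ud ν hν y u) (sq_nonneg _)
  obtain ⟨m, -, hm, hmS⟩ := exists_seq_tendsto_sInf hne hbdd
  choose u y hy hu hval using hmS
  have hM : ∀ n, ‖u n‖ ≤ R + ‖a‖ := fun n => by
    have := norm_add_le (u n - a) a
    rw [sub_add_cancel] at this
    linarith [hu n]
  obtain ⟨k, u', y', hk, h1, h2, h3⟩ :=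
    exists_subseq_control_state hC hP (fun _ => hγ) hy hM
  refine ⟨u', y', solvesRegularized_of_tendsto (fun n => hy (k n)) h1 h2 h3,
    norm_sub_le_of_weak_tendsto (fun n => hu (k n)) h1, fun v z hz hv => ?_⟩
  -- Both control terms, cost and penalty, are bounded below by their tangents at the weak limit, so
  -- the limit pair has value at most `sInf S`.
  have hlow := (tendsto_objectiveLower yd ud ν h1 h3).add
    ((((by simpa only [inner_sub_left] using (h1 (u' - a)).sub_const ⟪a, u' - a⟫ :
      Tendsto (fun n => ⟪u (k n) - a, u' - a⟫) atTop (𝓝 ⟪u' - a, u' - a⟫)).const_mul 2)).sub_const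
      (‖u' - a‖ ^ 2))
  have hle := le_of_tendsto_of_tendsto' hlow (hm.comp hk.tendsto_atTop) fun n => by
    have e1 := objectiveLower_le yd ud ν hν u' (y (k n)) (u (k n))
    have e2 := two_inner_sub_le (u (k n) - a) (u' - a)
    rw [Function.comp_apply, hval]
    linarith
  rw [real_inner_self_eq_norm_sq] at hle
  have hinf : sInf S ≤ objective (Ω := Ω) yd ud ν z v + ‖v - a‖ ^ 2 :=
    csInf_le hbdd ⟨v, z, hz, hv, rfl⟩
  linarith

/-- The penalized regularized problem has a (global, hence local) solution. -/
lemma exists_isLocalSolutionPγ (hν : 0 ≤ ν) {C : ℝ} (hC : 0 < C)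
    (hP : ∀ y : State Ω, ‖stateL Ω y‖ ≤ C * ‖gradL Ω y‖) {γ : ℝ} (hγ : 0 ≤ γ) (a : L2 Ω) :
    ∃ u : L2 Ω, IsLocalSolutionPγ yd ud ν a γ u := by
  obtain ⟨z, hz⟩ := exists_solvesRegularized hP hγ a
  set m := objective (Ω := Ω) yd ud ν z a with hm
  have hm0 : 0 ≤ m := objective_nonneg yd ud ν hν z a
  obtain ⟨u, y, hy, hu, hmin⟩ :=
    -- Outside the ball of radius `√m` the penalty alone is at least `m`, the value of the feasible
    -- pair `(z, a)`. The minimizer over this ball is therefore global, and the radius `1` below is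
    -- arbitrary.
    exists_minimizer_on_ball yd ud ν hν hC hP hγ a (Real.sqrt_nonneg m)
  refine ⟨u, y, hy, 1, one_pos, fun u' y' hy' _ => ?_⟩
  by_cases h : ‖u' - a‖ ≤ Real.sqrt m
  · exact hmin u' y' hy' h
  · have h1 := hmin a z hz (by simp)
    rw [sub_self, norm_zero, zero_pow two_ne_zero, add_zero] at h1
    have h2 : m ≤ ‖u' - a‖ ^ 2 := (Real.sqrt_le_left (norm_nonneg _)).1 (le_of_not_ge h)
    have h3 := objective_nonneg yd ud ν hν y' u'
    show objective (Ω := Ω) yd ud ν y u + ‖u - a‖ ^ 2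
      ≤ objective (Ω := Ω) yd ud ν y' u' + ‖u' - a‖ ^ 2
    linarith

/-- Minimizers over a ball of local optimality of `ubar` accumulate at `ubar`. -/
lemma exists_subseq_minimizers_tendsto (hν : 0 ≤ ν) {C : ℝ} (hC : 0 < C)
    (hP : ∀ y : State Ω, ‖stateL Ω y‖ ≤ C * ‖gradL Ω y‖) {ubar : L2 Ω} {ybar : State Ω} {ε : ℝ}
    (hε : 0 ≤ ε) (hbar : SolvesVI (Ω := Ω) ubar ybar)
    (hopt : ∀ (u : L2 Ω) (y : State Ω), SolvesVI (Ω := Ω) u y → ‖u - ubar‖ ≤ ε →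
      objective (Ω := Ω) yd ud ν ybar ubar ≤ objective (Ω := Ω) yd ud ν y u)
    {γ : ℕ → ℝ} (hγ : ∀ n, 0 < γ n) (hγ' : Tendsto γ atTop atTop)
    {u : ℕ → L2 Ω} {y : ℕ → State Ω} (hy : ∀ n, SolvesRegularized (Ω := Ω) (γ n) (u n) (y n))
    (hu : ∀ n, ‖u n - ubar‖ ≤ ε)
    (hmin : ∀ n (u' : L2 Ω) (y' : State Ω), SolvesRegularized (Ω := Ω) (γ n) u' y' →
      ‖u' - ubar‖ ≤ ε → objective (Ω := Ω) yd ud ν (y n) (u n) + ‖u n - ubar‖ ^ 2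
          ≤ objective (Ω := Ω) yd ud ν y' u' + ‖u' - ubar‖ ^ 2) :
    ∃ k : ℕ → ℕ, Tendsto (fun n => u (k n)) atTop (𝓝 ubar) := by
  have hM : ∀ n, ‖u n‖ ≤ ε + ‖ubar‖ := fun n => by
    have := norm_add_le (u n - ubar) ubar
    rw [sub_add_cancel] at this
    linarith [hu n]
  obtain ⟨k, u', y', hk, h1, h2, h3⟩ :=
    exists_subseq_control_state hC hP (fun n => (hγ n).le) hy hM
  refine ⟨k, ?_⟩
  have hγk := hγ'.comp hk.tendsto_atTop
  have hVI : SolvesVI (Ω := Ω) u' y' :=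
    solvesVI_of_tendsto (fun n => hγ (k n)) hγk (fun n => hM (k n)) (fun n => hy (k n)) h1 h2 h3
  have hJ := hopt u' y' hVI (norm_sub_le_of_weak_tendsto (fun n => hu (k n)) h1)
  -- The competitors: regularized states for the control `ubar` itself, for which the penalty
  -- vanishes.
  choose z hz using fun n => exists_solvesRegularized hP (hγ n).le ubar
  have hzlim : Tendsto (fun n => stateL Ω (z (k n))) atTop (𝓝 (stateL Ω ybar)) := by
    rw [tendsto_iff_norm_sub_tendsto_zero]
    have hsq : Tendsto (fun n => ‖stateL Ω (z (k n)) - stateL Ω ybar‖ ^ 2) atTop (𝓝 0) := by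
      refine squeeze_zero (fun n => sq_nonneg _)
        (fun n => norm_sub_sq_le_of_solvesVI hP (hγ (k n)) (hz (k n)) hbar) ?_
      simpa using (hγk.const_div_atTop _).const_mul (C ^ 2)
    simpa only [Real.sqrt_sq (norm_nonneg _), Real.sqrt_zero] using hsq.sqrt
  have hJz : Tendsto (fun n => objective (Ω := Ω) yd ud ν (z (k n)) ubar) atTop
      (𝓝 (objective (Ω := Ω) yd ud ν ybar ubar)) :=
    ((((hzlim.sub_const yd).norm.pow 2).const_mul (1 / 2)).add_const _)
  have hdiff : Tendsto (fun n => ‖u (k n) - ubar‖ ^ 2) atTop (𝓝 0) := by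
    have hup := hJz.sub (tendsto_objectiveLower yd ud ν h1 h3)
    have hle : ∀ n, ‖u (k n) - ubar‖ ^ 2 ≤ objective (Ω := Ω) yd ud ν (z (k n)) ubar
        - objectiveLower yd ud ν u' (y (k n)) (u (k n)) := fun n => by
      have e1 := hmin (k n) ubar (z (k n)) (hz (k n)) (by simpa using hε)
      rw [sub_self, norm_zero, zero_pow two_ne_zero, add_zero] at e1
      have e2 := objectiveLower_le yd ud ν hν u' (y (k n)) (u (k n))
      linarith
    have hlim := le_of_tendsto_of_tendsto' tendsto_const_nhds hup
      fun n => (sq_nonneg ‖u (k n) - ubar‖).trans (hle n)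
    -- The upper bound for the penalty tends to this difference. It is at most zero by local
    -- optimality of `ubar`, and at least zero as a limit of nonnegative numbers.
    have e : objective (Ω := Ω) yd ud ν ybar ubar - objective (Ω := Ω) yd ud ν y' u' = 0 :=
      le_antisymm (sub_nonpos.2 hJ) hlim
    rw [e] at hup
    exact squeeze_zero (fun n => sq_nonneg _) hle hup
  rw [tendsto_iff_norm_sub_tendsto_zero]
  simpa only [Real.sqrt_sq (norm_nonneg _), Real.sqrt_zero] using hdiff.sqrt

end Finite

/-- A minimizer over a ball that lies in the interior of the ball is a local solution. -/
lemma isLocalSolutionPγ_of_minimizer {yd ud : L2 Ω} {ν γ ε : ℝ} {a u : L2 Ω} {y : State Ω}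
    (hy : SolvesRegularized (Ω := Ω) γ u y) (hu : ‖u - a‖ < ε)
    (hmin : ∀ (u' : L2 Ω) (y' : State Ω), SolvesRegularized (Ω := Ω) γ u' y' → ‖u' - a‖ ≤ ε →
      objective (Ω := Ω) yd ud ν y u + ‖u - a‖ ^ 2
        ≤ objective (Ω := Ω) yd ud ν y' u' + ‖u' - a‖ ^ 2) :
    IsLocalSolutionPγ yd ud ν a γ u := by
  refine ⟨y, hy, ε - ‖u - a‖, sub_pos.2 hu, fun u' y' hy' h => hmin u' y' hy' ?_⟩
  have := norm_add_le (u' - u) (u - a)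
  rw [sub_add_sub_cancel] at this
  linarith

end VIControl

end

/-! ### Assembly of the family of local solutions. -/

theorem theoremB2 (d : ℕ) (hd : 1 ≤ d)
    (Ω : TopologicalSpace.Opens (VIControl.Space d))
    (hΩ : Bornology.IsBounded (Ω : Set (VIControl.Space d)))
    (yd ud : VIControl.L2 Ω) (ν : ℝ) (hν : 0 < ν)
    (ubar : VIControl.L2 Ω) (hubar : VIControl.IsLocalSolutionP yd ud ν ubar) :
    ∃ u : ℝ → VIControl.L2 Ω,
      (∀ γ : ℝ, 0 < γ → VIControl.IsLocalSolutionPγ yd ud ν ubar γ (u γ)) ∧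
      Tendsto u atTop (𝓝 ubar) := by
  classical
  have := VIControl.isFiniteMeasure_restrict hΩ
  obtain ⟨C, hC, hP⟩ := VIControl.poincare hd hΩ
  obtain ⟨ybar, hbar, ε, hε, hopt⟩ := hubar
  -- Positivity of `γ` sits inside the existential so that the choice is a function on all of `ℝ`;
  -- the value `0` for `γ ≤ 0` is irrelevant.
  have hball : ∀ γ : ℝ, ∃ (u : VIControl.L2 Ω) (y : VIControl.State Ω), 0 < γ →
      VIControl.SolvesRegularized (Ω := Ω) γ u y ∧ ‖u - ubar‖ ≤ ε ∧
      ∀ (u' : VIControl.L2 Ω) (y' : VIControl.State Ω),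
        VIControl.SolvesRegularized (Ω := Ω) γ u' y' → ‖u' - ubar‖ ≤ ε →
        VIControl.objective (Ω := Ω) yd ud ν y u + ‖u - ubar‖ ^ 2
          ≤ VIControl.objective (Ω := Ω) yd ud ν y' u' + ‖u' - ubar‖ ^ 2 := fun γ => by
    by_cases hγ : 0 < γ
    · obtain ⟨u, y, h⟩ :=
        VIControl.exists_minimizer_on_ball yd ud ν hν.le hC hP hγ.le ubar hε.le
      exact ⟨u, y, fun _ => h⟩
    · exact ⟨0, 0, fun h => absurd h hγ⟩
  choose u y huy using hball
  have hglobal : ∀ γ : ℝ, ∃ w : VIControl.L2 Ω, 0 < γ →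
      VIControl.IsLocalSolutionPγ yd ud ν ubar γ w := fun γ => by
    by_cases hγ : 0 < γ
    · obtain ⟨w, hw⟩ := VIControl.exists_isLocalSolutionPγ yd ud ν hν.le hC hP hγ.le ubar
      exact ⟨w, fun _ => hw⟩
    · exact ⟨0, fun h => absurd h hγ⟩
  choose w hw using hglobal
  have hlim : Tendsto u atTop (𝓝 ubar) := by
    refine tendsto_of_subseq_tendsto fun γ hγ => ?_
    -- The first `N` terms are dropped, since a sequence tending to infinity may start with
    -- nonpositive parameters.
    obtain ⟨N, hN⟩ := eventually_atTop.1 (hγ.eventually_gt_atTop 0)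
    have hpos : ∀ n, 0 < γ (n + N) := fun n => hN _ (Nat.le_add_left _ _)
    obtain ⟨k, hk⟩ := VIControl.exists_subseq_minimizers_tendsto yd ud ν hν.le hC hP hε.le hbar
      (fun u y hy hu => hopt u y hy hu) hpos (hγ.comp (tendsto_add_atTop_nat N))
      (fun n => (huy _ (hpos n)).1) (fun n => (huy _ (hpos n)).2.1)
      (fun n => (huy _ (hpos n)).2.2)
    exact ⟨fun n => k n + N, hk⟩
  -- A minimizer on the boundary of the ball need not be a local solution, so it is replaced by a
  -- global one; this does not happen for large `γ`, hence the limit is unaffected.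
  refine ⟨fun γ => if ‖u γ - ubar‖ < ε then u γ else w γ, fun γ hγ => ?_, ?_⟩
  · by_cases h : ‖u γ - ubar‖ < ε
    · simp only [h, if_true]
      exact VIControl.isLocalSolutionPγ_of_minimizer (huy γ hγ).1 h (huy γ hγ).2.2
    · simp only [h, if_false]
      exact hw γ hγ
  · refine hlim.congr' ?_
    filter_upwards [(tendsto_iff_norm_sub_tendsto_zero.1 hlim).eventually_lt_const hε] with γ h
    rw [if_pos h]
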